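/- Local convergence of alternating projections for Gaussian phase retrieval. Conventions: $\|\cdot\|$ is the Euclidean norm; for $z\in\mathbb{C}$, $\mathrm{phase}(z)=z/|z|$ if $z\neq 0$ and $\mathrm{phase}(0)=1$; $|\cdot|$ and $\mathrm{phase}$ act on vectors coordinatewise; $\odot$ is the coordinatewise product; $A^\dagger$ is the Moore-Penrose pseudo-inverse of $A$. There exist absolute constants $\epsilon, C_1, C_2, M>0$ and $\delta\in(0,1)$ such that the following holds for all positive integers $n,m$ with $m\geq Mn$ and all fixed $x_0\in\mathbb{C}^n$. Let $a_1,\dots,a_m\in\mathbb{C}^n$ be independent random vectors whose coordinates are independent standard complex Gaussian variables (the real and imaginary parts of each coordinate are independent real normal variables with mean $0$ and variance $1/2$). Let $A\in\mathbb{C}^{m\times n}$ be the matrix with rows $a_1^*,\dots,a_m^*$, and let $b=|Ax_0|$. Then, with probability at least $$1-C_1\exp(-C_2m),$$ every $x\in\mathbb{C}^n$ such that $$\inf_{\phi\in\mathbb{R}}\|e^{i\phi}x_0-x\|\leq\epsilon\|x_0\|$$ satisfies $$\inf_{\phi\in\mathbb{R}}\big\|e^{i\phi}x_0-A^\dagger\big(b\odot\mathrm{phase}(Ax)\big)\big\|\leq\delta\,\inf_{\phi\in\mathbb{R}}\|e^{i\phi}x_0-x\|.$$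 -/

import Mathlib

open MeasureTheory ProbabilityTheory Matrix

/-- The phase `z / |z|` of a complex number, with the convention `phase 0 = 1`. -/
noncomputable def phase (z : ℂ) : ℂ := if z = 0 then 1 else z / (‖z‖ : ℂ)

/-- The four Penrose conditions: `B` is a Moore-Penrose pseudo-inverse of `A`. -/
structure IsMoorePenrose {m n : ℕ} (A : Matrix (Fin m) (Fin n) ℂ)
    (B : Matrix (Fin n) (Fin m) ℂ) : Prop where
  mul_mul_self : A * B * A = A
  self_mul_mul : B * A * B = B
  isHermitian_mul : (A * B).IsHermitian
  isHermitian_mul' : (B * A).IsHermitian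

open scoped ComplexOrder in
/-- Every matrix has a Moore-Penrose pseudo-inverse. -/
theorem exists_isMoorePenrose {m n : ℕ} (A : Matrix (Fin m) (Fin n) ℂ) :
    ∃ B, IsMoorePenrose A B := by
  set H : Matrix (Fin n) (Fin n) ℂ := Aᴴ * A with hH
  have hsa : IsSelfAdjoint H := (Matrix.isHermitian_conjTranspose_mul_self A).isSelfAdjoint
  have hc : ∀ f : ℝ → ℝ, ContinuousOn f (spectrum ℝ H) :=
    fun f => (Matrix.finite_real_spectrum (A := H)).continuousOn f
  set G : Matrix (Fin n) (Fin n) ℂ := cfc (fun t : ℝ => t⁻¹) H with hG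
  have hGH : G * H = cfc (fun t : ℝ => t⁻¹ * t) H := by
    rw [cfc_mul _ _ H (hc _) (hc _), cfc_id' ℝ H]
  have hHG : H * G = cfc (fun t : ℝ => t * t⁻¹) H := by
    rw [cfc_mul _ _ H (hc _) (hc _), cfc_id' ℝ H]
  have hcomm : H * G = G * H := by rw [hGH, hHG]; simp only [mul_comm]
  have hHGH : H * G * H = H := by
    have : H * G * H = cfc (fun t : ℝ => t * t⁻¹ * t) H := by
      rw [cfc_mul _ _ H (hc _) (hc _), cfc_id' ℝ H, hHG]
    rw [this]
    simp only [mul_inv_mul_cancel, cfc_id' ℝ H]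
  have hGHG : G * H * G = G := by
    have : G * H * G = cfc (fun t : ℝ => t⁻¹ * t * t⁻¹) H := by
      rw [cfc_mul (fun t : ℝ => t⁻¹ * t) _ H (hc _) (hc _), hGH]
    rw [this, hG]
    congr 1
    funext t
    simpa using mul_inv_mul_cancel t⁻¹
  have hGs : Gᴴ = G := IsSelfAdjoint.cfc (f := fun t : ℝ => t⁻¹) (a := H)
  have hHs : Hᴴ = H := hsa
  have hAGH : A * (G * H) = A := by
    have h0 : (A * (G * H) - A)ᴴ * (A * (G * H) - A) = 0 := by
      have e : A * (G * H) - A = A * (G * H - 1) := by rw [Matrix.mul_sub, Matrix.mul_one]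
      rw [e, Matrix.conjTranspose_mul, Matrix.mul_assoc, ← Matrix.mul_assoc Aᴴ, ← hH,
        Matrix.mul_sub, ← Matrix.mul_assoc H G H, hHGH, Matrix.mul_one, sub_self,
        Matrix.mul_zero]
    exact sub_eq_zero.mp (Matrix.conjTranspose_mul_self_eq_zero.mp h0)
  refine ⟨G * Aᴴ, ?_, ?_, ?_, ?_⟩
  · rw [← Matrix.mul_assoc, Matrix.mul_assoc (A * G), ← hH, Matrix.mul_assoc, hAGH]
  · rw [Matrix.mul_assoc G, ← hH, ← Matrix.mul_assoc, hGHG]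
  · rw [Matrix.IsHermitian, Matrix.conjTranspose_mul, Matrix.conjTranspose_mul,
      Matrix.conjTranspose_conjTranspose, hGs, Matrix.mul_assoc]
  · rw [Matrix.IsHermitian, Matrix.mul_assoc, ← hH, Matrix.conjTranspose_mul, hGs, hHs, hcomm]

/-- The Moore-Penrose pseudo-inverse of a complex matrix. -/
noncomputable def pinv {m n : ℕ} (A : Matrix (Fin m) (Fin n) ℂ) : Matrix (Fin n) (Fin m) ℂ :=
  Classical.choose (exists_isMoorePenrose A)

theorem pinv_spec {m n : ℕ} (A : Matrix (Fin m) (Fin n) ℂ) : IsMoorePenrose A (pinv A) :=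
  Classical.choose_spec (exists_isMoorePenrose A)

/-- The pseudo-inverse is the only matrix that satisfies the Penrose conditions. -/
theorem IsMoorePenrose.eq_pinv {m n : ℕ} {A : Matrix (Fin m) (Fin n) ℂ}
    {B : Matrix (Fin n) (Fin m) ℂ} (h : IsMoorePenrose A B) : B = pinv A := by
  have k := pinv_spec A
  set C := pinv A
  have h1 : A * B = A * C := by
    have e : A * C * (A * B) = A * B := by rw [← Matrix.mul_assoc, k.mul_mul_self]
    have e' : A * B * (A * C) = A * C := by rw [← Matrix.mul_assoc, h.mul_mul_self]
    have t := congrArg Matrix.conjTranspose e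
    rw [Matrix.conjTranspose_mul, h.isHermitian_mul, k.isHermitian_mul, e'] at t
    exact t.symm
  have h2 : B * A = C * A := by
    have e : B * A * (C * A) = B * A := by
      rw [Matrix.mul_assoc, ← Matrix.mul_assoc A, k.mul_mul_self]
    have e' : C * A * (B * A) = C * A := by
      rw [Matrix.mul_assoc, ← Matrix.mul_assoc A, h.mul_mul_self]
    have t := congrArg Matrix.conjTranspose e
    rw [Matrix.conjTranspose_mul, h.isHermitian_mul', k.isHermitian_mul', e'] at t
    exact t.symm
  calc B = B * A * B := h.self_mul_mul.symm
    _ = C * A * C := by rw [h2, Matrix.mul_assoc, h1, Matrix.mul_assoc]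
    _ = C := k.self_mul_mul

/-- The measurement matrix: its `i`-th row is the conjugate transpose of the sensing vector
`a i`. -/
def measurementMatrix {m n : ℕ} (a : Fin m → Fin n → ℂ) : Matrix (Fin m) (Fin n) ℂ :=
  Matrix.of fun i j => star (a i j)

/-- The law of `X + i Y`, where `X` and `Y` are independent real normal variables with mean `0`
and variance `1 / 2`. -/
noncomputable def complexGaussian : Measure ℂ :=
  ((gaussianReal 0 (1 / 2)).prod (gaussianReal 0 (1 / 2))).map
    fun p : ℝ × ℝ => (p.1 : ℂ) + (p.2 : ℂ) * Complex.I

instance : IsProbabilityMeasure complexGaussian :=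
  Measure.isProbabilityMeasure_map (by fun_prop)

/-- The joint law of `m` independent sensing vectors in `ℂⁿ`, each of which has independent
standard complex normal coordinates. -/
noncomputable def sensingLaw (m n : ℕ) : Measure (Fin m → Fin n → ℂ) :=
  Measure.pi fun _ => Measure.pi fun _ => complexGaussian

instance (m n : ℕ) : IsProbabilityMeasure (sensingLaw m n) := by
  unfold sensingLaw; infer_instance

/-- The vector `b = |A x₀|` of phaseless measurements. -/
noncomputable def measurements {m n : ℕ} (A : Matrix (Fin m) (Fin n) ℂ)
    (x₀ : EuclideanSpace ℂ (Fin n)) : Fin m → ℝ :=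
  fun i => ‖(A *ᵥ x₀.ofLp) i‖

/-- The alternating projections operator `x ↦ A† (b ⊙ phase (A x))`. -/
noncomputable def altProj {m n : ℕ} (A : Matrix (Fin m) (Fin n) ℂ) (b : Fin m → ℝ)
    (x : EuclideanSpace ℂ (Fin n)) : EuclideanSpace ℂ (Fin n) :=
  WithLp.toLp 2 (pinv A *ᵥ fun i => (b i : ℂ) * phase ((A *ᵥ x.ofLp) i))

/-- The distance between `x₀` and `x` up to a global phase, `inf_φ ‖e^{iφ} x₀ - x‖`. -/
noncomputable def phaseDist {n : ℕ} (x₀ x : EuclideanSpace ℂ (Fin n)) : ℝ :=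
  ⨅ φ : ℝ, ‖Complex.exp (φ * Complex.I) • x₀ - x‖

/-! After removing the optimal global phase, write `x = ω (x₀ + y)` with `⟨x₀, y⟩` real. On an event
where `A` is injective, the new error is `A†` applied to a vector `v` that compares `|A x₀| ⊙ phase
(A x)` with `ω A x₀`. Where `|A y|` is small relative to `|A x₀|`, replacing the phase moves an
entry, to first order, only by the component of `A y` tangential to `A x₀`
(`norm_mul_phase_sub_le`).

The gain comes from this component. Since `⟨x₀, y⟩` is real, only the part of `y` orthogonal to `x₀`
contributes; its measurements are independent of `A x₀`, so the tangential component is a real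
Gaussian carrying half the variance. Thus the tangential vector has norm about `√(m/2) ‖y‖` at most,
whereas `‖A y‖` is about `√m ‖y‖`: a contraction by roughly `1/√2`, leaving room for errors.

The remaining entries, with `|A x₀| ≤ 10 |A y|`, have small total energy: either `|A y|` is
unusually large, or `|A x₀|` is unusually small, which is rare and does not depend on `y`
(`GoodOn.sum_large_le`).

All estimates are made uniform in `y` by Chernoff bounds on a net of the sphere and Lipschitz or
operator-norm extension (`exists_measurableSet_goodOn`, `opNorm_le_of_net`). The contraction itself
is deterministic: `GoodOn.phaseDist_altProj_le`. -/

/-! ### Joint law of one or two measurements -/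

/-- The value `a* x`, as a real-linear function of `a`. -/
noncomputable def sense {n : ℕ} (x : Fin n → ℂ) : (Fin n → ℂ) →L[ℝ] ℂ :=
  ∑ j, ((ContinuousLinearMap.mul ℝ ℂ).flip (x j)) ∘L
    ((Complex.conjCLE : ℂ →L[ℝ] ℂ) ∘L ContinuousLinearMap.proj (R := ℝ) (φ := fun _ : Fin n => ℂ) j)

theorem sense_apply {n : ℕ} (x a : Fin n → ℂ) : sense x a = ∑ j, star (a j) * x j := by
  simp [sense, mul_comm]

theorem charFunDual_complexGaussian (ℓ : StrongDual ℝ ℂ) :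
    charFunDual complexGaussian ℓ =
      Complex.exp (((-(ℓ 1 ^ 2 + ℓ Complex.I ^ 2) / 4 : ℝ)) : ℂ) := by
  let T : ℝ × ℝ →L[ℝ] ℂ := Complex.equivRealProdCLM.symm
  have hT : (fun p : ℝ × ℝ => (p.1 : ℂ) + (p.2 : ℂ) * Complex.I) = T := by
    funext p
    simp [T, Complex.equivRealProdCLM_symm_apply]
  have key : ∀ L : StrongDual ℝ ℝ, charFunDual (gaussianReal 0 (1 / 2)) L =
      Complex.exp ((-(L 1 ^ 2) / 4 : ℝ) : ℂ) := by
    intro L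
    have h : charFunDual (gaussianReal 0 (1 / 2)) L = charFun (gaussianReal 0 (1 / 2)) (L 1) := by
      rw [charFunDual_apply, charFun_apply_real]
      congr 1
      funext x
      have : L x = x * L 1 := by
        conv_lhs => rw [← mul_one x, ← smul_eq_mul, map_smul, smul_eq_mul]
      rw [this]
      push_cast
      ring_nf
    rw [h, charFun_gaussianReal]
    congr 1
    push_cast
    ring
  rw [complexGaussian, hT, charFunDual_map, charFunDual_prod, key, key, ← Complex.exp_add]
  congr 1
  simp [T, Complex.equivRealProdCLM_symm_apply]
  ring

/-- The characteristic function sees `ℓ` only through `ℓ 1 ^ 2 + ℓ I ^ 2`, which a rotation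
preserves. -/
theorem complexGaussian_map_mul {c : ℂ} (hc : ‖c‖ = 1) :
    complexGaussian.map (fun z => c * z) = complexGaussian := by
  have h1 : (fun z => c * z) = ContinuousLinearMap.mul ℝ ℂ c := by ext; simp
  rw [h1]
  apply Measure.ext_of_charFunDual
  ext ℓ
  rw [charFunDual_map, charFunDual_complexGaussian, charFunDual_complexGaussian]
  have hl : ∀ z : ℂ, ℓ z = z.re * ℓ 1 + z.im * ℓ Complex.I := by
    intro z
    conv_lhs => rw [← Complex.re_add_im z]
    have e1 : (z.re : ℂ) = z.re • (1 : ℂ) := by simp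
    have e2 : (z.im : ℂ) * Complex.I = z.im • Complex.I := by simp
    rw [map_add, e1, e2, map_smul, map_smul, smul_eq_mul, smul_eq_mul]
  congr 3
  simp only [ContinuousLinearMap.comp_apply, ContinuousLinearMap.mul_apply', mul_one]
  rw [hl c, hl (c * Complex.I)]
  have hn : c.re ^ 2 + c.im ^ 2 = 1 := by
    have := Complex.sq_norm c
    rw [hc, Complex.normSq_apply] at this
    nlinarith
  simp
  linear_combination (-(ℓ 1 ^ 2 + ℓ Complex.I ^ 2)) * hn

/-- In the characteristic function of the pair, the cross terms are multiples of the real and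
imaginary parts of `⟨v, u⟩`. Orthogonality therefore gives independence, which is what decouples the
tangential component from `A x₀`. -/
theorem map_sense_prod {n : ℕ} (u v : EuclideanSpace ℂ (Fin n)) (huv : inner ℂ v u = 0) :
    (Measure.pi fun _ : Fin n => complexGaussian).map (fun a => (sense u.ofLp a, sense v.ofLp a)) =
      (complexGaussian.prod complexGaussian).map
        (fun p => ((‖u‖ : ℂ) * p.1, (‖v‖ : ℂ) * p.2)) := by
  have h1 : (fun a => (sense u.ofLp a, sense v.ofLp a)) =
      (sense u.ofLp).prod (sense v.ofLp) := by ext <;> simp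
  have h2 : (fun p : ℂ × ℂ => ((‖u‖ : ℂ) * p.1, (‖v‖ : ℂ) * p.2)) =
      (‖u‖ • ContinuousLinearMap.fst ℝ ℂ ℂ).prod (‖v‖ • ContinuousLinearMap.snd ℝ ℂ ℂ) := by
    ext <;> simp
  rw [h1, h2]
  apply Measure.ext_of_charFunDual
  ext ℓ
  rw [charFunDual_map, charFunDual_map, charFunDual_prod, charFunDual_pi]
  simp_rw [charFunDual_complexGaussian]
  rw [← Complex.exp_sum, ← Complex.exp_add, ← Complex.ofReal_add, ← Complex.ofReal_sum]
  congr 2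
  set p := ℓ (1, 0) with hp
  set q := ℓ (Complex.I, 0) with hq
  set s := ℓ (0, 1) with hs
  set t := ℓ (0, Complex.I) with ht
  have hl : ∀ z w : ℂ, ℓ (z, w) = z.re * p + z.im * q + (w.re * s + w.im * t) := by
    intro z w
    have e : (z, w) = z.re • ((1 : ℂ), (0 : ℂ)) + z.im • (Complex.I, (0 : ℂ)) +
      (w.re • ((0 : ℂ), (1 : ℂ)) + w.im • ((0 : ℂ), Complex.I)) := by
      ext <;> simp
    rw [e]
    simp only [map_add, map_smul, smul_eq_mul, hp, hq, hs, ht]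
  have hsing : ∀ (x : EuclideanSpace ℂ (Fin n)) (j : Fin n) (c : ℂ),
      sense x.ofLp (Pi.single j c) = star c * x j := by
    intro x j c
    rw [sense_apply, Finset.sum_eq_single j]
    · simp
    · intro b _ hb; simp [hb]
    · simp
  simp only [ContinuousLinearMap.comp_apply, ContinuousLinearMap.prod_apply,
    ContinuousLinearMap.single_apply, hsing, hl, ContinuousLinearMap.inl_apply,
    ContinuousLinearMap.inr_apply]
  have hu := EuclideanSpace.norm_sq_eq u
  have hv := EuclideanSpace.norm_sq_eq v
  simp only [Complex.sq_norm, Complex.normSq_apply] at hu hv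
  have hi : ∑ j, u j * star (v j) = 0 := by
    rw [← huv, PiLp.inner_apply]
    simp
  have hre := congrArg Complex.re hi
  have him := congrArg Complex.im hi
  simp at hre him
  simp
  have key : ∀ x : Fin n,
      (-((u x).im * p + -((u x).re * q) + ((v x).im * s + -((v x).re * t))) ^ 2 +
          -((u x).re * p + (u x).im * q + ((v x).re * s + (v x).im * t)) ^ 2) / 4 =
      -(p ^ 2 + q ^ 2) / 4 * ((u x).re * (u x).re + (u x).im * (u x).im) +
      -(s ^ 2 + t ^ 2) / 4 * ((v x).re * (v x).re + (v x).im * (v x).im) +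
      -(p * s + q * t) / 2 * ((u x).re * (v x).re + (u x).im * (v x).im) +
      -(q * s - p * t) / 2 * (-((u x).re * (v x).im) + (u x).im * (v x).re) := by
    intro x
    ring
  rw [Finset.sum_congr rfl fun x _ => key x, Finset.sum_add_distrib, Finset.sum_add_distrib,
    Finset.sum_add_distrib, ← Finset.mul_sum, ← Finset.mul_sum, ← Finset.mul_sum, ← Finset.mul_sum,
    ← hu, ← hv, hre, him]
  ring

/-! ### Exponential moments of the Gaussian -/

open ENNReal in
theorem lintegral_exp_sq_gaussianReal {s : ℝ} (hs : s < 1) :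
    ∫⁻ x, ENNReal.ofReal (Real.exp (s * x ^ 2)) ∂(gaussianReal 0 (1 / 2)) =
      ENNReal.ofReal (1 / √(1 - s)) := by
  have h1 : 0 < 1 - s := by linarith
  -- The tilted density is, up to the factor `1 / √(1 - s)`, again a centred Gaussian density, with
  -- this variance.
  let v : NNReal := ⟨1 / (2 * (1 - s)), by positivity⟩
  have hv : v ≠ 0 := by
    intro h
    have := congrArg NNReal.toReal h
    have h2 : 1 / (2 * (1 - s)) = 0 := this
    exact absurd h2 (by positivity)
  rw [gaussianReal_of_var_ne_zero _ (by norm_num),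
    lintegral_withDensity_eq_lintegral_mul _ (measurable_gaussianPDF _ _) (by fun_prop)]
  have key : ∀ x : ℝ, (gaussianPDF 0 (1 / 2) * fun x => ENNReal.ofReal (Real.exp (s * x ^ 2))) x =
      ENNReal.ofReal (1 / √(1 - s)) * gaussianPDF 0 v x := by
    intro x
    rw [Pi.mul_apply, gaussianPDF, gaussianPDF, ← ENNReal.ofReal_mul (gaussianPDFReal_nonneg _ _ _),
      ← ENNReal.ofReal_mul (by positivity), gaussianPDFReal, gaussianPDFReal, mul_assoc,
      ← Real.exp_add, ← mul_assoc]
    congr 2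
    · have : ((v : NNReal) : ℝ) = 1 / (2 * (1 - s)) := rfl
      rw [this, one_div (√(1 - s)), ← mul_inv, ← Real.sqrt_mul h1.le]
      congr 2
      push_cast
      field_simp
    · have : ((v : NNReal) : ℝ) = 1 / (2 * (1 - s)) := rfl
      rw [this]
      push_cast
      congr 1
      field_simp
      ring
  simp_rw [key]
  rw [lintegral_const_mul _ (measurable_gaussianPDF _ _), lintegral_gaussianPDF_eq_one _ hv, mul_one]

theorem lintegral_complexGaussian {f : ℂ → ENNReal} (hf : Measurable f) :
    ∫⁻ z, f z ∂complexGaussian = ∫⁻ p : ℝ × ℝ, f (p.1 + p.2 * Complex.I)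
      ∂((gaussianReal 0 (1 / 2)).prod (gaussianReal 0 (1 / 2))) := by
  rw [complexGaussian, lintegral_map hf (by fun_prop)]

theorem lintegral_exp_norm_sq {s : ℝ} (hs : s < 1) :
    ∫⁻ z, ENNReal.ofReal (Real.exp (s * ‖z‖ ^ 2)) ∂complexGaussian =
      ENNReal.ofReal (1 / (1 - s)) := by
  have h1 : 0 < 1 - s := by linarith
  rw [lintegral_complexGaussian (by fun_prop)]
  have : ∀ p : ℝ × ℝ, ENNReal.ofReal (Real.exp (s * ‖(p.1 + p.2 * Complex.I : ℂ)‖ ^ 2)) =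
      ENNReal.ofReal (Real.exp (s * p.1 ^ 2)) * ENNReal.ofReal (Real.exp (s * p.2 ^ 2)) := by
    intro p
    rw [← ENNReal.ofReal_mul (by positivity), ← Real.exp_add, Complex.sq_norm,
      Complex.normSq_add_mul_I]
    ring_nf
  simp_rw [this]
  rw [lintegral_prod_mul (f := fun x : ℝ => ENNReal.ofReal (Real.exp (s * x ^ 2)))
    (g := fun x : ℝ => ENNReal.ofReal (Real.exp (s * x ^ 2))) (by fun_prop) (by fun_prop),
    lintegral_exp_sq_gaussianReal hs, ← ENNReal.ofReal_mul (by positivity)]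
  congr 1
  rw [one_div_mul_one_div, Real.mul_self_sqrt h1.le]

theorem lintegral_exp_im_sq {s : ℝ} (hs : s < 1) {c : ℂ} (hc : ‖c‖ = 1) :
    ∫⁻ z, ENNReal.ofReal (Real.exp (s * (c * z).im ^ 2)) ∂complexGaussian =
      ENNReal.ofReal (1 / √(1 - s)) := by
  rw [← lintegral_exp_sq_gaussianReal hs,
    ← lintegral_map (μ := complexGaussian) (g := fun z => c * z)
      (f := fun z : ℂ => ENNReal.ofReal (Real.exp (s * z.im ^ 2))) (by fun_prop) (by fun_prop),
    complexGaussian_map_mul hc, lintegral_complexGaussian (by fun_prop)]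
  simp only [Complex.add_im, Complex.ofReal_im, Complex.mul_im, Complex.I_im, Complex.ofReal_re,
    Complex.I_re, mul_one, mul_zero, add_zero, zero_add]
  rw [lintegral_prod _ (by fun_prop)]
  simp

/-! ### Chernoff bound -/

/-- Markov's inequality at level 1 for the product of the exponentials. The tilt and the threshold
are both absorbed into `f`, so that one form serves upper and lower tails alike. -/
theorem measure_sum_nonneg_le {Ω : Type*} [MeasurableSpace Ω] (μ : Measure Ω)
    [IsProbabilityMeasure μ] {f : Ω → ℝ} (hf : Measurable f) {ρ : ℝ}
    (h : ∫⁻ ω, ENNReal.ofReal (Real.exp (f ω)) ∂μ ≤ ENNReal.ofReal (Real.exp (-ρ))) (m : ℕ) :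
    (Measure.pi fun _ : Fin m => μ).real {a | 0 ≤ ∑ k, f (a k)} ≤ Real.exp (-ρ * m) := by
  have h1 : ∫⁻ a, ∏ k, ENNReal.ofReal (Real.exp (f (a k))) ∂(Measure.pi fun _ : Fin m => μ) =
      ∏ _k : Fin m, ∫⁻ ω, ENNReal.ofReal (Real.exp (f ω)) ∂μ := by
    rw [lintegral_prod_eq_prod_lintegral_of_indepFun Finset.univ
      (fun k (a : Fin m → Ω) => ENNReal.ofReal (Real.exp (f (a k))))
      (iIndepFun_pi (μ := fun _ : Fin m => μ)
        (X := fun _ ω => ENNReal.ofReal (Real.exp (f ω))) fun _ => by fun_prop)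
      (fun k => by fun_prop)]
    refine Finset.prod_congr rfl fun k _ => ?_
    exact (measurePreserving_eval (fun _ : Fin m => μ) k).lintegral_comp
      (f := fun ω => ENNReal.ofReal (Real.exp (f ω))) (by fun_prop)
  have h2 := mul_meas_ge_le_lintegral (μ := Measure.pi fun _ : Fin m => μ)
    (f := fun a => ∏ k, ENNReal.ofReal (Real.exp (f (a k)))) (by fun_prop) 1
  rw [h1, one_mul] at h2
  have h3 : {a : Fin m → Ω | 0 ≤ ∑ k, f (a k)} ⊆
      {a | 1 ≤ ∏ k, ENNReal.ofReal (Real.exp (f (a k)))} := by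
    intro a ha
    simp only [Set.mem_ofPred_eq] at ha ⊢
    rw [← ENNReal.ofReal_prod_of_nonneg (fun _ _ => by positivity), ← Real.exp_sum,
      ENNReal.one_le_ofReal]
    exact Real.one_le_exp ha
  have h4 : (Measure.pi fun _ : Fin m => μ) {a | 0 ≤ ∑ k, f (a k)} ≤
      ENNReal.ofReal (Real.exp (-ρ * m)) := by
    refine (measure_mono h3).trans (h2.trans ?_)
    refine (Finset.prod_le_prod' fun _ _ => h).trans ?_
    rw [Finset.prod_const, Finset.card_univ, Fintype.card_fin, ← ENNReal.ofReal_pow (by positivity),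
      ← Real.exp_nat_mul, mul_comm]
  exact ENNReal.toReal_le_of_le_ofReal (by positivity) h4

/-! ### Nets of the unit sphere -/

open Module Metric Function in
-- Volume comparison: the balls of radius `r / 2` around the points are disjoint and lie in the ball
-- of radius `3 / 2`.
theorem card_le_of_separated_of_norm_le_one {E : Type*} [NormedAddCommGroup E] [NormedSpace ℝ E]
    [FiniteDimensional ℝ E] {r : ℝ} (hr : 0 < r) (hr1 : r ≤ 1) (s : Finset E)
    (hs : ∀ c ∈ s, ‖c‖ ≤ 1) (h : ∀ c ∈ s, ∀ d ∈ s, c ≠ d → r ≤ ‖c - d‖) :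
    (s.card : ℝ) ≤ (3 / r) ^ finrank ℝ E := by
  borelize E
  let μ : Measure E := Measure.addHaar
  have hδ : 0 < r / 2 := by positivity
  have ρpos : (0 : ℝ) < 3 / 2 := by norm_num
  set A := ⋃ c ∈ s, ball (c : E) (r / 2) with hA
  have D : Set.Pairwise (s : Set E) (Disjoint on fun c => ball (c : E) (r / 2)) := by
    rintro c hc d hd hcd
    apply ball_disjoint_ball
    rw [dist_eq_norm]
    linarith [h c hc d hd hcd]
  have A_subset : A ⊆ ball (0 : E) (3 / 2) := by
    refine Set.iUnion₂_subset fun x hx => ?_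
    apply ball_subset_ball'
    rw [dist_zero_right]
    linarith [hs x hx]
  have I : (s.card : ENNReal) * ENNReal.ofReal ((r / 2) ^ finrank ℝ E) * μ (ball 0 1) ≤
      ENNReal.ofReal ((3 / 2) ^ finrank ℝ E) * μ (ball 0 1) :=
    calc
      (s.card : ENNReal) * ENNReal.ofReal ((r / 2) ^ finrank ℝ E) * μ (ball 0 1) = μ A := by
        rw [hA, measure_biUnion_finset D fun c _ => measurableSet_ball]
        simp only [μ.addHaar_ball_of_pos _ hδ]
        simp only [Finset.sum_const, nsmul_eq_mul, mul_assoc]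
      _ ≤ μ (ball (0 : E) (3 / 2)) := measure_mono A_subset
      _ = ENNReal.ofReal ((3 / 2) ^ finrank ℝ E) * μ (ball 0 1) := by
        simp only [μ.addHaar_ball_of_pos _ ρpos]
  have J : (s.card : ENNReal) * ENNReal.ofReal ((r / 2) ^ finrank ℝ E) ≤
      ENNReal.ofReal ((3 / 2) ^ finrank ℝ E) :=
    (ENNReal.mul_le_mul_iff_left (measure_ball_pos _ _ zero_lt_one).ne' measure_ball_lt_top.ne).1 I
  have K := ENNReal.toReal_le_of_le_ofReal (pow_nonneg ρpos.le _) J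
  rw [ENNReal.toReal_mul, ENNReal.toReal_natCast, ENNReal.toReal_ofReal (by positivity),
    ← le_div_iff₀ (by positivity), ← div_pow] at K
  refine K.trans (le_of_eq ?_)
  congr 1
  field_simp

/-- The unit sphere has an `r`-net with at most `(3 / r) ^ dim` points. -/
theorem exists_sphere_net (E : Type*) [NormedAddCommGroup E] [NormedSpace ℝ E]
    [FiniteDimensional ℝ E] {r : ℝ} (hr : 0 < r) (hr1 : r ≤ 1) :
    ∃ N : Finset E, (∀ c ∈ N, ‖c‖ = 1) ∧ (N.card : ℝ) ≤ (3 / r) ^ Module.finrank ℝ E ∧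
      ∀ x : E, ‖x‖ = 1 → ∃ c ∈ N, ‖x - c‖ ≤ r := by
  classical
  -- A separated subset of the sphere of maximal cardinality is a net, since an uncovered point
  -- could be added to it.
  let S : Set ℕ := {k | ∃ s : Finset E, (∀ c ∈ s, ‖c‖ = 1) ∧
    (∀ c ∈ s, ∀ d ∈ s, c ≠ d → r ≤ ‖c - d‖) ∧ s.card = k}
  have hne : S.Nonempty := ⟨0, ∅, by simp⟩
  have hb : BddAbove S := by
    refine ⟨⌊(3 / r) ^ Module.finrank ℝ E⌋₊, ?_⟩
    rintro k ⟨s, h1, h2, rfl⟩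
    exact Nat.le_floor (card_le_of_separated_of_norm_le_one hr hr1 s (fun c hc => (h1 c hc).le) h2)
  obtain ⟨N, h1, h2, h3⟩ := Nat.sSup_mem hne hb
  refine ⟨N, h1, card_le_of_separated_of_norm_le_one hr hr1 N (fun c hc => (h1 c hc).le) h2,
    fun x hx => ?_⟩
  by_contra! hcon
  have hxN : x ∉ N := by
    intro hxN
    have := hcon x hxN
    simp at this
    linarith
  have hmem : (insert x N).card ∈ S := by
    refine ⟨insert x N, ?_, ?_, rfl⟩
    · intro c hc
      rcases Finset.mem_insert.1 hc with rfl | hc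
      · exact hx
      · exact h1 c hc
    · intro c hc d hd hcd
      rcases Finset.mem_insert.1 hc with rfl | hc' <;>
        rcases Finset.mem_insert.1 hd with rfl | hd'
      · exact absurd rfl hcd
      · exact (hcon d hd').le
      · rw [norm_sub_rev]; exact (hcon c hc').le
      · exact h2 c hc' d hd' hcd
  have := le_csSup hb hmem
  rw [Finset.card_insert_of_notMem hxN, h3] at this
  omega

/-- A bound on a net of the unit sphere bounds the operator norm. -/
theorem opNorm_le_of_net {E F : Type*} [NormedAddCommGroup E] [NormedSpace ℝ E]
    [NormedAddCommGroup F] [NormedSpace ℝ F] {r : ℝ} (hr1 : r < 1) {N : Finset E}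
    (hN : ∀ x : E, ‖x‖ = 1 → ∃ c ∈ N, ‖x - c‖ ≤ r) (T : E →L[ℝ] F) {C : ℝ} (hC : 0 ≤ C)
    (h : ∀ c ∈ N, ‖T c‖ ≤ C) (x : E) : ‖T x‖ ≤ C / (1 - r) * ‖x‖ := by
  have h0 : ‖T‖ ≤ C + ‖T‖ * r := by
    -- For negative `r` the net hypothesis forces the unit sphere to be empty.
    by_cases hr : 0 ≤ r
    · refine T.opNorm_le_of_unit_norm (by positivity) fun x hx => ?_
      obtain ⟨c, hc, hxc⟩ := hN x hx
      calc ‖T x‖ = ‖T c + T (x - c)‖ := by rw [map_sub]; congr 1; abel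
        _ ≤ ‖T c‖ + ‖T (x - c)‖ := norm_add_le _ _
        _ ≤ C + ‖T‖ * r := add_le_add (h c hc) (T.le_opNorm_of_le hxc)
    · have : ‖T‖ ≤ 0 := by
        refine T.opNorm_le_of_unit_norm le_rfl fun x hx => ?_
        obtain ⟨c, hc, hxc⟩ := hN x hx
        exact absurd ((norm_nonneg _).trans hxc) hr
      have : ‖T‖ = 0 := le_antisymm this (norm_nonneg _)
      rw [this]; linarith
  have h1 : ‖T‖ ≤ C / (1 - r) := by
    rw [le_div_iff₀ (by linarith)]
    linarith
  exact T.le_of_opNorm_le h1 x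

/-! ### Exponential moments for the five good-event conditions -/

theorem lintegral_comp_sense {n : ℕ} (u : EuclideanSpace ℂ (Fin n)) {F : ℂ → ENNReal}
    (hF : Measurable F) :
    ∫⁻ a, F (sense u.ofLp a) ∂(Measure.pi fun _ : Fin n => complexGaussian) =
      ∫⁻ z, F (‖u‖ * z) ∂complexGaussian := by
  have h := map_sense_prod u 0 (by simp)
  have h2 := congrArg (fun μ => ∫⁻ p, F p.1 ∂μ) h
  simp only at h2
  rw [lintegral_map (by fun_prop) (by fun_prop), lintegral_map (by fun_prop) (by fun_prop)] at h2
  rw [h2, lintegral_prod _ (by fun_prop)]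
  simp

theorem lintegral_exp_norm_sense_sq {n : ℕ} {u : EuclideanSpace ℂ (Fin n)} (hu : ‖u‖ = 1)
    {s : ℝ} (hs : s < 1) :
    ∫⁻ a, ENNReal.ofReal (Real.exp (s * ‖sense u.ofLp a‖ ^ 2))
      ∂(Measure.pi fun _ : Fin n => complexGaussian) = ENNReal.ofReal (1 / (1 - s)) := by
  rw [lintegral_comp_sense u (F := fun z => ENNReal.ofReal (Real.exp (s * ‖z‖ ^ 2)))
    (by fun_prop), hu, ← lintegral_exp_norm_sq hs]
  simp

/-- Adding a constant to the exponent multiplies the exponential moment. -/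
theorem lintegral_exp_add_const {Ω : Type*} [MeasurableSpace Ω] (μ : Measure Ω) (f : Ω → ℝ)
    (c : ℝ) :
    ∫⁻ ω, ENNReal.ofReal (Real.exp (f ω + c)) ∂μ =
      (∫⁻ ω, ENNReal.ofReal (Real.exp (f ω)) ∂μ) * ENNReal.ofReal (Real.exp c) := by
  rw [← lintegral_mul_const' _ _ ENNReal.ofReal_ne_top]
  refine lintegral_congr fun ω => ?_
  rw [Real.exp_add, ENNReal.ofReal_mul (by positivity)]

theorem lintegral_exp_upper {n : ℕ} {u : EuclideanSpace ℂ (Fin n)} (hu : ‖u‖ = 1) :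
    ∫⁻ a, ENNReal.ofReal (Real.exp (1 / 2 * ‖sense u.ofLp a‖ ^ 2 + (-2)))
      ∂(Measure.pi fun _ : Fin n => complexGaussian) ≤
        ENNReal.ofReal (Real.exp (-(1 / 10 ^ 9))) := by
  rw [lintegral_exp_add_const (f := fun a => 1 / 2 * ‖sense u.ofLp a‖ ^ 2),
    lintegral_exp_norm_sense_sq hu (by norm_num), ← ENNReal.ofReal_mul (by norm_num)]
  apply ENNReal.ofReal_le_ofReal
  have h1 : Real.exp 1 * Real.exp (-2) ≤ Real.exp (-(1 / 10 ^ 9)) := by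
    rw [← Real.exp_add]
    apply Real.exp_le_exp.2
    norm_num
  have h2 := Real.add_one_le_exp 1
  have h3 : 0 < Real.exp (-2) := Real.exp_pos _
  norm_num at h1 h2 ⊢
  nlinarith

/-- The threshold `98 / 100` is close to the mean `1`, so the tilt must be small: at `1 / 100` the
bound rests on `98 / 10000 < log (101 / 100)`. -/
theorem lintegral_exp_lower {n : ℕ} {u : EuclideanSpace ℂ (Fin n)} (hu : ‖u‖ = 1) :
    ∫⁻ a, ENNReal.ofReal (Real.exp (-(1 / 100) * ‖sense u.ofLp a‖ ^ 2 + 98 / 10000))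
      ∂(Measure.pi fun _ : Fin n => complexGaussian) ≤
        ENNReal.ofReal (Real.exp (-(1 / 10 ^ 9))) := by
  rw [lintegral_exp_add_const (f := fun a => -(1 / 100) * ‖sense u.ofLp a‖ ^ 2),
    lintegral_exp_norm_sense_sq hu (by norm_num), ← ENNReal.ofReal_mul (by norm_num)]
  apply ENNReal.ofReal_le_ofReal
  have h1 : Real.exp (98 / 10000) = Real.exp (98 / 10000 + 1 / 10 ^ 9) *
      Real.exp (-(1 / 10 ^ 9)) := by
    rw [← Real.exp_add]; congr 1; ring
  have h2 : Real.exp (98 / 10000 + 1 / 10 ^ 9) ≤ 101 / 100 := by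
    have h := Real.add_one_le_exp (-(98 / 10000 + 1 / 10 ^ 9))
    rw [Real.exp_neg] at h
    have hp : 0 < Real.exp (98 / 10000 + 1 / 10 ^ 9) := Real.exp_pos _
    have h' := mul_le_mul_of_nonneg_left h hp.le
    rw [mul_inv_cancel₀ hp.ne'] at h'
    norm_num at h' ⊢
    linarith
  have h3 : 0 < Real.exp (-(1 / 10 ^ 9)) := Real.exp_pos _
  rw [h1]
  norm_num at h2 h3 ⊢
  nlinarith

/-- The indicator of `‖z‖ ≤ 10⁻⁵` is dominated by a steep Gaussian weight, whose mean is about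
`10⁻¹⁰`, well below the allowed frequency `10⁻⁸`. -/
theorem lintegral_exp_small {n : ℕ} (x : EuclideanSpace ℂ (Fin n)) (hx : x ≠ 0) :
    ∫⁻ a, ENNReal.ofReal (Real.exp
        ((if ‖sense x.ofLp a‖ ≤ 1 / 10 ^ 5 * ‖x‖ then (1 : ℝ) else 0) + -(1 / 10 ^ 8)))
      ∂(Measure.pi fun _ : Fin n => complexGaussian) ≤
        ENNReal.ofReal (Real.exp (-(1 / 10 ^ 9))) := by
  have hxp : 0 < ‖x‖ := norm_pos_iff.2 hx
  have hm : Measurable fun z : ℂ => ENNReal.ofReal (Real.exp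
      (if ‖z‖ ≤ 1 / 10 ^ 5 * ‖x‖ then (1 : ℝ) else 0)) := by
    refine ENNReal.measurable_ofReal.comp (Real.measurable_exp.comp ?_)
    exact Measurable.ite (measurableSet_le (by fun_prop) (by fun_prop)) (by fun_prop) (by fun_prop)
  rw [lintegral_exp_add_const (f := fun a => if ‖sense x.ofLp a‖ ≤ 1 / 10 ^ 5 * ‖x‖ then (1 : ℝ)
    else 0), lintegral_comp_sense x (F := fun z => ENNReal.ofReal (Real.exp
      (if ‖z‖ ≤ 1 / 10 ^ 5 * ‖x‖ then (1 : ℝ) else 0))) hm]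
  have h1 : ∀ z : ℂ, ENNReal.ofReal (Real.exp
      (if ‖(‖x‖ * z : ℂ)‖ ≤ 1 / 10 ^ 5 * ‖x‖ then (1 : ℝ) else 0)) ≤
      1 + ENNReal.ofReal (8 * Real.exp (-10 ^ 10 * ‖z‖ ^ 2)) := by
    intro z
    split_ifs with h
    · have hz : ‖z‖ ≤ 1 / 10 ^ 5 := by
        rw [norm_mul, Complex.norm_real, norm_norm, mul_comm] at h
        exact le_of_mul_le_mul_right h hxp
      have h2 : Real.exp (-1) ≤ Real.exp (-10 ^ 10 * ‖z‖ ^ 2) := by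
        apply Real.exp_le_exp.2
        have := pow_le_pow_left₀ (norm_nonneg z) hz 2
        norm_num at this ⊢
        linarith
      -- The factor 8 is a round bound for `e ^ 2`.
      have h3 : Real.exp 1 ≤ 8 * Real.exp (-1) := by
        have h4 := Real.exp_one_lt_d9
        have h5 := Real.exp_one_gt_d9
        rw [Real.exp_neg, ← div_eq_mul_inv, le_div_iff₀ (Real.exp_pos _)]
        nlinarith
      refine le_add_left (ENNReal.ofReal_le_ofReal ?_)
      linarith
    · simp
  calc _ ≤ (∫⁻ z, (1 + ENNReal.ofReal (8 * Real.exp (-10 ^ 10 * ‖z‖ ^ 2))) ∂complexGaussian) *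
        ENNReal.ofReal (Real.exp (-(1 / 10 ^ 8))) := by
        gcongr with z
        exact h1 z
    _ = (1 + ENNReal.ofReal (8 * (1 / (1 + 10 ^ 10)))) *
        ENNReal.ofReal (Real.exp (-(1 / 10 ^ 8))) := by
        congr 1
        rw [lintegral_add_left measurable_const]
        congr 1
        · simp
        · have := lintegral_exp_norm_sq (s := -10 ^ 10) (by norm_num)
          simp_rw [ENNReal.ofReal_mul (show (0 : ℝ) ≤ 8 by norm_num)]
          rw [lintegral_const_mul _ (by fun_prop), this, sub_neg_eq_add]
    _ ≤ _ := by
        rw [← ENNReal.ofReal_one, ← ENNReal.ofReal_add (by norm_num) (by norm_num),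
          ← ENNReal.ofReal_mul (by norm_num)]
        apply ENNReal.ofReal_le_ofReal
        have h2 := Real.add_one_le_exp (8 * (1 / (1 + 10 ^ 10)) : ℝ)
        calc _ ≤ Real.exp (8 * (1 / (1 + 10 ^ 10)) : ℝ) * Real.exp (-(1 / 10 ^ 8)) := by
              gcongr
              linarith
          _ ≤ _ := by
              rw [← Real.exp_add]
              apply Real.exp_le_exp.2
              norm_num

theorem lintegral_exp_tail {n : ℕ} {u : EuclideanSpace ℂ (Fin n)} (hu : ‖u‖ = 1) :
    ∫⁻ a, ENNReal.ofReal (Real.exp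
        (1 / 2 * max (‖sense u.ofLp a‖ - 10) 0 ^ 2 + -(1 / (2 * 10 ^ 6))))
      ∂(Measure.pi fun _ : Fin n => complexGaussian) ≤
        ENNReal.ofReal (Real.exp (-(1 / 10 ^ 9))) := by
  rw [lintegral_exp_add_const (f := fun a => 1 / 2 * max (‖sense u.ofLp a‖ - 10) 0 ^ 2),
    lintegral_comp_sense u
      (F := fun z => ENNReal.ofReal (Real.exp (1 / 2 * max (‖z‖ - 10) 0 ^ 2))) (by fun_prop), hu]
  have h1 : ∀ z : ℂ, ENNReal.ofReal (Real.exp (1 / 2 * max (‖((1 : ℝ) * z : ℂ)‖ - 10) 0 ^ 2)) ≤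
      1 + ENNReal.ofReal (Real.exp (-25) * Real.exp (3 / 4 * ‖z‖ ^ 2)) := by
    intro z
    rw [Complex.ofReal_one, one_mul]
    rcases le_total ‖z‖ 10 with h | h
    · rw [max_eq_right (by linarith)]
      simp
    · rw [max_eq_left (by linarith), ← Real.exp_add]
      refine le_add_left (ENNReal.ofReal_le_ofReal (Real.exp_le_exp.2 ?_))
      nlinarith
  calc _ ≤ (∫⁻ z, (1 + ENNReal.ofReal (Real.exp (-25) * Real.exp (3 / 4 * ‖z‖ ^ 2)))
          ∂complexGaussian) * ENNReal.ofReal (Real.exp (-(1 / (2 * 10 ^ 6)))) := by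
        gcongr with z
        exact h1 z
    _ = (1 + ENNReal.ofReal (Real.exp (-25) * 4)) *
        ENNReal.ofReal (Real.exp (-(1 / (2 * 10 ^ 6)))) := by
        congr 1
        rw [lintegral_add_left measurable_const]
        congr 1
        · simp
        · have := lintegral_exp_norm_sq (s := 3 / 4) (by norm_num)
          simp_rw [ENNReal.ofReal_mul (Real.exp_pos (-25)).le]
          rw [lintegral_const_mul _ (by fun_prop), this]
          norm_num
    _ ≤ _ := by
        rw [← ENNReal.ofReal_one, ← ENNReal.ofReal_add (by norm_num) (by positivity),
          ← ENNReal.ofReal_mul (by positivity)]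
        apply ENNReal.ofReal_le_ofReal
        have h2 := Real.add_one_le_exp (Real.exp (-25) * 4)
        have h3 : Real.exp (-25) ≤ (1 / 2) ^ 25 := by
          have h4 : Real.exp (-1) ≤ 1 / 2 := by
            rw [Real.exp_neg, inv_le_comm₀ (Real.exp_pos _) (by norm_num)]
            linarith [Real.add_one_le_exp 1]
          have h5 : Real.exp (-25) = Real.exp (-1) ^ 25 := by
            rw [← Real.exp_nat_mul]; norm_num
          rw [h5]
          exact pow_le_pow_left₀ (Real.exp_pos _).le h4 25
        calc _ ≤ Real.exp (Real.exp (-25) * 4) * Real.exp (-(1 / (2 * 10 ^ 6))) := by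
              gcongr
              linarith
          _ ≤ _ := by
              rw [← Real.exp_add]
              apply Real.exp_le_exp.2
              norm_num at h3 ⊢
              linarith

/-- Conditionally on the measurement of `x`, the quotient is the imaginary part of a rotated
independent Gaussian, hence real Gaussian of variance `‖w‖ ^ 2 / 2 ≤ 1 / 2`. The threshold `52 /
100` sits just above this variance, which is where the contraction is gained. -/
theorem lintegral_exp_im_div {n : ℕ} (x w : EuclideanSpace ℂ (Fin n)) (hx : x ≠ 0)
    (hw : ‖w‖ ≤ 1) (hxw : inner ℂ w x = 0) :
    ∫⁻ a, ENNReal.ofReal (Real.exp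
        (1 / 50 * ((star (sense x.ofLp a) * sense w.ofLp a).im / ‖sense x.ofLp a‖) ^ 2 +
          -(52 / 5000)))
      ∂(Measure.pi fun _ : Fin n => complexGaussian) ≤
        ENNReal.ofReal (Real.exp (-(1 / 10 ^ 9))) := by
  have hxp : 0 < ‖x‖ := norm_pos_iff.2 hx
  have hw2 : ‖w‖ ^ 2 ≤ 1 := pow_le_one₀ (norm_nonneg w) hw
  let F : ℂ × ℂ → ENNReal := fun p => ENNReal.ofReal (Real.exp
    (1 / 50 * ((star p.1 * p.2).im / ‖p.1‖) ^ 2))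
  have hF : Measurable F := by
    refine ENNReal.measurable_ofReal.comp (Real.measurable_exp.comp ?_)
    have : Measurable fun p : ℂ × ℂ => (star p.1 * p.2).im :=
      Complex.measurable_im.comp
        ((continuous_star.measurable.comp measurable_fst).mul measurable_snd)
    exact ((this.div measurable_fst.norm).pow_const 2).const_mul _
  have h := congrArg (fun μ => ∫⁻ p, F p ∂μ) (map_sense_prod x w hxw)
  simp only at h
  rw [lintegral_map hF (by fun_prop), lintegral_map hF (by fun_prop),
    lintegral_prod (fun p : ℂ × ℂ => F (‖x‖ * p.1, ‖w‖ * p.2))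
      (hF.comp (by fun_prop)).aemeasurable] at h
  rw [lintegral_exp_add_const (f := fun a => 1 / 50 *
    ((star (sense x.ofLp a) * sense w.ofLp a).im / ‖sense x.ofLp a‖) ^ 2), h]
  have h1 : ∀ z : ℂ, ∫⁻ y, F (‖x‖ * z, ‖w‖ * y) ∂complexGaussian ≤
      ENNReal.ofReal (1 / √(1 - 1 / 50)) := by
    intro z
    -- At `z = 0` the quotient is `0` by the convention for division, so the integrand is `1`.
    by_cases hz : z = 0
    · have : ∀ y : ℂ, F (‖x‖ * z, ‖w‖ * y) = 1 := by
        intro y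
        simp [F, hz]
      simp_rw [this]
      rw [lintegral_one, measure_univ, ENNReal.one_le_ofReal, le_div_iff₀ (by norm_num), one_mul]
      exact Real.sqrt_le_one.2 (by norm_num)
    · have hzp : 0 < ‖z‖ := norm_pos_iff.2 hz
      have hc : ‖star z / (‖z‖ : ℂ)‖ = 1 := by
        rw [norm_div, norm_star, Complex.norm_real, norm_norm, div_self hzp.ne']
      have : ∀ y : ℂ, F (‖x‖ * z, ‖w‖ * y) = ENNReal.ofReal (Real.exp
          (1 / 50 * ‖w‖ ^ 2 * (star z / (‖z‖ : ℂ) * y).im ^ 2)) := by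
        intro y
        have e1 : star (‖x‖ * z : ℂ) * (‖w‖ * y) =
            ((‖x‖ * ‖w‖ * ‖z‖ : ℝ) : ℂ) * (star z / (‖z‖ : ℂ) * y) := by
          have : (‖z‖ : ℂ) ≠ 0 := by exact_mod_cast hzp.ne'
          simp
          field_simp
        simp only [F]
        rw [e1, Complex.im_ofReal_mul, norm_mul, Complex.norm_real, norm_norm]
        congr 2
        field_simp
      simp_rw [this]
      rw [lintegral_exp_im_sq (by linarith) hc]
      apply ENNReal.ofReal_le_ofReal
      apply one_div_le_one_div_of_le (Real.sqrt_pos.2 (by norm_num))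
      apply Real.sqrt_le_sqrt
      linarith
  calc _ ≤ (∫⁻ _z, ENNReal.ofReal (1 / √(1 - 1 / 50)) ∂complexGaussian) *
        ENNReal.ofReal (Real.exp (-(52 / 5000))) := by
        gcongr with z
        exact h1 z
    _ = ENNReal.ofReal (1 / √(1 - 1 / 50) * Real.exp (-(52 / 5000))) := by
        rw [lintegral_const, measure_univ, mul_one, ← ENNReal.ofReal_mul (by positivity)]
    _ ≤ _ := by
        apply ENNReal.ofReal_le_ofReal
        rw [one_div_mul_eq_div, div_le_iff₀ (Real.sqrt_pos.2 (by norm_num))]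
        have e : Real.exp (-(52 / 5000)) = Real.exp (-(1 / 10 ^ 9)) *
            Real.exp (-(52 / 5000 - 1 / 10 ^ 9)) := by
          rw [← Real.exp_add]; congr 1; ring
        rw [e]
        gcongr
        apply Real.le_sqrt_of_sq_le
        rw [← Real.exp_nat_mul, mul_neg, Real.exp_neg]
        apply inv_le_of_inv_le₀ (by norm_num)
        refine le_trans ?_ (Real.add_one_le_exp _)
        norm_num

/-! ### Perturbation of the phase -/

theorem measurementMatrix_mulVec {m n : ℕ} (a : Fin m → Fin n → ℂ) (x : Fin n → ℂ) (k : Fin m) :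
    (measurementMatrix a *ᵥ x) k = sense x (a k) := by
  rw [sense_apply]
  rfl

theorem norm_phase (z : ℂ) : ‖phase z‖ = 1 := by
  unfold phase
  split_ifs with h
  · simp
  · rw [norm_div, Complex.norm_real, norm_norm, div_self (norm_ne_zero_iff.2 h)]

/-- The phase is, to first order, controlled by the component of the perturbation that is
orthogonal to the base point. -/
theorem norm_mul_phase_sub_le (z₀ z : ℂ) :
    ‖(‖z₀‖ : ℂ) * phase z - z₀‖ ≤ 2 * (if ‖z₀‖ ≤ 10 * ‖z - z₀‖ then ‖z₀‖ else 0) +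
      10 / 9 * |(star z₀ * (z - z₀)).im / ‖z₀‖| := by
  -- If the perturbation is not small, only `‖phase z‖ = 1` is used; this case also covers `z = 0`,
  -- so the convention for `phase 0` has no effect on the bound.
  split_ifs with h
  · have h1 : ‖(‖z₀‖ : ℂ) * phase z - z₀‖ ≤ 2 * ‖z₀‖ := by
      refine (norm_sub_le _ _).trans ?_
      rw [norm_mul, norm_phase, Complex.norm_real, norm_norm]
      linarith
    have h2 : 0 ≤ 10 / 9 * |(star z₀ * (z - z₀)).im / ‖z₀‖| := by positivity
    linarith
  · rw [mul_zero, zero_add]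
    push Not at h
    have hR : 0 < ‖z₀‖ := by linarith [norm_nonneg (z - z₀)]
    have hz : z ≠ 0 := by
      rintro rfl
      rw [zero_sub, norm_neg] at h
      linarith
    have hD : 0 < ‖z‖ := norm_pos_iff.2 hz
    have hR2 := Complex.sq_norm z₀
    have hD2 := Complex.sq_norm z
    have hre : -(‖z₀‖ * ‖z - z₀‖) ≤ (star z₀ * (z - z₀)).re := by
      have := Complex.abs_re_le_norm (star z₀ * (z - z₀))
      rw [norm_mul, norm_star] at this
      exact (abs_le.1 this).1
    set R := ‖z₀‖
    set D := ‖z‖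
    obtain ⟨x, y⟩ := z
    obtain ⟨u, v⟩ := z₀
    simp only [Complex.normSq_apply] at hR2 hD2
    -- With `p` and `q` the real and imaginary parts of `star z₀ * z`, the squared error is `2 R (R
    -- D - p) / D`. It is quadratic in `q` because `R D - p = q ^ 2 / (R D + p)`, and this lower
    -- bound on `p` controls the denominators.
    have hp : 9 / 10 * R ^ 2 ≤ u * x + v * y := by
      simp at hre
      nlinarith
    set p := u * x + v * y with hpdef
    set q := u * y - v * x with hqdef
    have hpq : p ^ 2 + q ^ 2 = R ^ 2 * D ^ 2 := by
      rw [hR2, hD2]; ring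
    have hpp : 0 < p := by nlinarith [pow_pos hR 2]
    have hpRD : p ≤ R * D := by
      apply abs_le_of_sq_le_sq' _ (by positivity) |>.2
      nlinarith [sq_nonneg q]
    have him : (star (⟨u, v⟩ : ℂ) * (⟨x, y⟩ - ⟨u, v⟩)).im = q := by
      simp [hqdef]
      ring
    rw [him]
    apply abs_le_of_sq_le_sq' _ (by positivity) |>.2
    have hL : ‖(R : ℂ) * phase ⟨x, y⟩ - ⟨u, v⟩‖ ^ 2 = 2 * R * (R * D - p) / D := by
      rw [phase, if_neg hz, Complex.sq_norm, Complex.normSq_apply]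
      have e : (R : ℂ) * (⟨x, y⟩ / (D : ℂ)) = ((R / D : ℝ) : ℂ) * ⟨x, y⟩ := by
        push_cast; ring
      rw [e]
      simp
      field_simp
      have e2 : x ^ 2 + y ^ 2 = D ^ 2 := by rw [hD2]; ring
      have e3 : u ^ 2 + v ^ 2 = R ^ 2 := by rw [hR2]; ring
      linear_combination R ^ 2 * e2 + D ^ 2 * e3
    rw [hL, mul_pow, sq_abs, div_pow q R, div_le_iff₀ hD]
    have hRD : R * D - p = q ^ 2 / (R * D + p) := by
      rw [eq_div_iff (by positivity)]
      linear_combination -hpq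
    have h1 : q ^ 2 / (R * D + p) ≤ q ^ 2 / (2 * p) := by gcongr; linarith
    have h2 : 2 * R * (q ^ 2 / (2 * p)) = R * q ^ 2 / p := by field_simp
    have h3 : R * q ^ 2 / p ≤ (10 / 9) ^ 2 * (q ^ 2 / R ^ 2) * D := by
      rw [div_le_iff₀ hpp]
      have h4 : (10 / 9) ^ 2 * (q ^ 2 / R ^ 2) * D * p = q ^ 2 / R ^ 3 * ((10 / 9) ^ 2 * (R * D) * p) := by
        field_simp
      have h5 : R * q ^ 2 = q ^ 2 / R ^ 3 * R ^ 4 := by field_simp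
      rw [h4, h5]
      gcongr
      have h6 : (9 / 10 * R ^ 2) * (9 / 10 * R ^ 2) ≤ R * D * p := by
        apply mul_le_mul (hp.trans hpRD) hp (by positivity) (by positivity)
      nlinarith
    calc 2 * R * (R * D - p) ≤ 2 * R * (q ^ 2 / (2 * p)) := by rw [hRD]; gcongr
      _ ≤ _ := by rw [h2]; exact h3

/-! ### The pseudo-inverse and the optimal phase -/

theorem norm_mulVec_le_of_isHermitian_of_mul_self {m : ℕ} {P : Matrix (Fin m) (Fin m) ℂ}
    (hP : P.IsHermitian) (hPP : P * P = P) (v : Fin m → ℂ) :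
    ‖WithLp.toLp 2 (P *ᵥ v)‖ ≤ ‖WithLp.toLp 2 v‖ := by
  have h : inner ℂ (WithLp.toLp 2 (P *ᵥ v)) (WithLp.toLp 2 (P *ᵥ v)) =
      inner ℂ (WithLp.toLp 2 v) (WithLp.toLp 2 (P *ᵥ v)) := by
    rw [EuclideanSpace.inner_eq_star_dotProduct, EuclideanSpace.inner_eq_star_dotProduct]
    simp only
    rw [star_mulVec, hP.eq, dotProduct_comm, ← dotProduct_mulVec, mulVec_mulVec, hPP,
      dotProduct_comm]
  have h1 : ‖WithLp.toLp 2 (P *ᵥ v)‖ ^ 2 ≤ ‖WithLp.toLp 2 v‖ * ‖WithLp.toLp 2 (P *ᵥ v)‖ := by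
    have h2 := norm_inner_le_norm (𝕜 := ℂ) (WithLp.toLp 2 v) (WithLp.toLp 2 (P *ᵥ v))
    rw [← h, inner_self_eq_norm_sq_to_K] at h2
    simpa using h2
  by_contra! hlt
  nlinarith [norm_nonneg (WithLp.toLp 2 v)]

theorem pinv_mulVec_mulVec {m n : ℕ} {A : Matrix (Fin m) (Fin n) ℂ} {σ : ℝ} (hσ : 0 < σ)
    (hA : ∀ x : EuclideanSpace ℂ (Fin n), σ * ‖x‖ ≤ ‖WithLp.toLp 2 (A *ᵥ x.ofLp)‖)
    (x : Fin n → ℂ) : pinv A *ᵥ (A *ᵥ x) = x := by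
  have h := hA (WithLp.toLp 2 (pinv A *ᵥ (A *ᵥ x) - x))
  have h0 : A *ᵥ (pinv A *ᵥ (A *ᵥ x) - x) = 0 := by
    rw [mulVec_sub, mulVec_mulVec, mulVec_mulVec, (pinv_spec A).mul_mul_self, sub_self]
  simp only [h0, WithLp.toLp_zero, norm_zero] at h
  have h1 : ‖WithLp.toLp 2 (pinv A *ᵥ (A *ᵥ x) - x)‖ = 0 :=
    le_antisymm (by nlinarith [norm_nonneg (WithLp.toLp 2 (pinv A *ᵥ (A *ᵥ x) - x))]) (norm_nonneg _)
  have h2 := congrArg WithLp.ofLp (norm_eq_zero.1 h1)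
  exact sub_eq_zero.1 h2

/-- `A A†` is an orthogonal projection, so `σ ‖A† v‖ ≤ ‖A A† v‖ ≤ ‖v‖`. -/
theorem norm_pinv_mulVec_le {m n : ℕ} {A : Matrix (Fin m) (Fin n) ℂ} {σ : ℝ}
    (hA : ∀ x : EuclideanSpace ℂ (Fin n), σ * ‖x‖ ≤ ‖WithLp.toLp 2 (A *ᵥ x.ofLp)‖)
    (v : Fin m → ℂ) : σ * ‖WithLp.toLp 2 (pinv A *ᵥ v)‖ ≤ ‖WithLp.toLp 2 v‖ := by
  refine (hA _).trans ?_
  simp only [mulVec_mulVec]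
  have h := pinv_spec A
  refine norm_mulVec_le_of_isHermitian_of_mul_self h.isHermitian_mul ?_ v
  rw [← Matrix.mul_assoc, h.mul_mul_self]

/-- The infimum over global phases is attained at a phase that makes the inner product real. -/
theorem exists_phaseDist_eq {n : ℕ} (x₀ x : EuclideanSpace ℂ (Fin n)) :
    ∃ φ : ℝ, phaseDist x₀ x = ‖Complex.exp (φ * Complex.I) • x₀ - x‖ ∧
      (inner ℂ (Complex.exp (φ * Complex.I) • x₀) x).im = 0 := by
  -- Expanding the squared distance leaves only `-2 Re ⟨e^{iφ} x₀, x⟩` depending on the phase; this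
  -- choice makes that inner product equal to its modulus.
  set φ := (inner ℂ x₀ x).arg with hφ
  have hinner : inner ℂ (Complex.exp (φ * Complex.I) • x₀) x = (‖inner ℂ x₀ x‖ : ℂ) := by
    rw [inner_smul_left]
    conv_lhs => rw [← Complex.norm_mul_exp_arg_mul_I (inner ℂ x₀ x)]
    rw [← hφ, ← Complex.exp_conj, mul_left_comm, ← Complex.exp_add]
    simp
  refine ⟨φ, ?_, by rw [hinner]; simp⟩
  refine le_antisymm (ciInf_le ⟨0, ?_⟩ φ) (le_ciInf fun ψ => ?_)
  · rintro _ ⟨ψ, rfl⟩; exact norm_nonneg _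
  · apply le_of_sq_le_sq _ (norm_nonneg _)
    rw [@norm_sub_sq ℂ, @norm_sub_sq ℂ, norm_smul, norm_smul, Complex.norm_exp_ofReal_mul_I,
      Complex.norm_exp_ofReal_mul_I, hinner]
    have h1 : RCLike.re (inner ℂ (Complex.exp (ψ * Complex.I) • x₀) x) ≤ ‖inner ℂ x₀ x‖ := by
      refine (RCLike.re_le_norm _).trans ?_
      rw [inner_smul_left, norm_mul, RCLike.norm_conj, Complex.norm_exp_ofReal_mul_I, one_mul]
    have h2 : RCLike.re ((‖inner ℂ x₀ x‖ : ℝ) : ℂ) = ‖inner ℂ x₀ x‖ := by simp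
    rw [h2]
    linarith

theorem phaseDist_le {n : ℕ} (x₀ x : EuclideanSpace ℂ (Fin n)) (φ : ℝ) :
    phaseDist x₀ x ≤ ‖Complex.exp (φ * Complex.I) • x₀ - x‖ :=
  ciInf_le ⟨0, by rintro _ ⟨ψ, rfl⟩; exact norm_nonneg _⟩ φ

/-! ### Measurement and tangential maps -/

/-- The measurement map `x ↦ A x`. -/
noncomputable def sensing {m n : ℕ} (a : Fin m → Fin n → ℂ) :
    EuclideanSpace ℂ (Fin n) →L[ℂ] EuclideanSpace ℂ (Fin m) :=
  LinearMap.toContinuousLinearMap (Matrix.toEuclideanLin (measurementMatrix a))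

theorem sensing_apply {m n : ℕ} (a : Fin m → Fin n → ℂ) (x : EuclideanSpace ℂ (Fin n)) :
    sensing a x = WithLp.toLp 2 (measurementMatrix a *ᵥ x.ofLp) := rfl

theorem sensing_apply_apply {m n : ℕ} (a : Fin m → Fin n → ℂ) (x : EuclideanSpace ℂ (Fin n))
    (k : Fin m) : sensing a x k = sense x.ofLp (a k) := by
  rw [sensing_apply]
  exact measurementMatrix_mulVec a x.ofLp k

theorem norm_sensing_sq {m n : ℕ} (a : Fin m → Fin n → ℂ) (x : EuclideanSpace ℂ (Fin n)) :
    ‖sensing a x‖ ^ 2 = ∑ k, ‖sense x.ofLp (a k)‖ ^ 2 := by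
  rw [EuclideanSpace.norm_sq_eq]
  simp_rw [sensing_apply_apply]

/-- The component of `x` orthogonal to `x₀`. -/
noncomputable def orthComp {n : ℕ} (x₀ : EuclideanSpace ℂ (Fin n)) :
    EuclideanSpace ℂ (Fin n) →L[ℂ] EuclideanSpace ℂ (Fin n) :=
  (ℂ ∙ x₀)ᗮ.starProjection

theorem norm_orthComp_le {n : ℕ} (x₀ x : EuclideanSpace ℂ (Fin n)) : ‖orthComp x₀ x‖ ≤ ‖x‖ :=
  Submodule.norm_starProjection_apply_le _ x

theorem inner_orthComp {n : ℕ} (x₀ x : EuclideanSpace ℂ (Fin n)) :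
    inner ℂ (orthComp x₀ x) x₀ = 0 :=
  Submodule.mem_orthogonal_singleton_iff_inner_left.1
    (Submodule.starProjection_apply_mem _ x)

theorem orthComp_eq {n : ℕ} (x₀ x : EuclideanSpace ℂ (Fin n)) :
    orthComp x₀ x = x - (inner ℂ x₀ x / ((‖x₀‖ ^ 2 : ℝ) : ℂ)) • x₀ := by
  rw [orthComp, Submodule.starProjection_orthogonal', _root_.sub_apply,
    Submodule.starProjection_singleton]
  simp

/-- The map `x ↦ Im (conj (A x₀) ⊙ A x') / |A x₀|`, where `x'` is the component of `x` orthogonal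
to `x₀`. -/
noncomputable def tangentialMap {m n : ℕ} (a : Fin m → Fin n → ℂ) (x₀ : EuclideanSpace ℂ (Fin n)) :
    EuclideanSpace ℂ (Fin n) →L[ℝ] EuclideanSpace ℝ (Fin m) :=
  LinearMap.toContinuousLinearMap
    { toFun := fun x => WithLp.toLp 2 fun k =>
        (star (sensing a x₀ k) * sensing a (orthComp x₀ x) k).im / ‖sensing a x₀ k‖
      map_add' := fun x y => by
        ext k
        simp only [map_add, PiLp.add_apply, mul_add, Complex.add_im, add_div]
      map_smul' := fun c x => by
        ext k
        have h : orthComp x₀ (c • x) = (c : ℂ) • orthComp x₀ x := by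
          rw [← map_smul]; rfl
        have h' : sensing a ((c : ℂ) • orthComp x₀ x) k = c * sensing a (orthComp x₀ x) k := by
          rw [map_smul]; rfl
        simp only [h, h', PiLp.smul_apply, RingHom.id_apply, smul_eq_mul]
        rw [mul_left_comm, Complex.im_ofReal_mul, mul_div_assoc] }

theorem tangentialMap_apply {m n : ℕ} (a : Fin m → Fin n → ℂ) (x₀ x : EuclideanSpace ℂ (Fin n))
    (k : Fin m) : tangentialMap a x₀ x k =
      (star (sensing a x₀ k) * sensing a (orthComp x₀ x) k).im / ‖sensing a x₀ k‖ := rfl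

/-- The discarded component is a real multiple of `x₀`, and `star (A x₀) * A x₀` is real entrywise,
so the projection can be dropped. Keeping it in the definition makes the map real-linear on the
whole space while retaining independence from `A x₀`. -/
theorem tangentialMap_apply_of_im_inner_eq_zero {m n : ℕ} (a : Fin m → Fin n → ℂ)
    (x₀ x : EuclideanSpace ℂ (Fin n)) (h : (inner ℂ x₀ x).im = 0) (k : Fin m) :
    tangentialMap a x₀ x k = (star (sensing a x₀ k) * sensing a x k).im / ‖sensing a x₀ k‖ := by
  rw [tangentialMap_apply, orthComp_eq]
  congr 1
  obtain ⟨c, hc⟩ : ∃ c : ℝ, inner ℂ x₀ x / ((‖x₀‖ ^ 2 : ℝ) : ℂ) = c := by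
    refine ⟨(inner ℂ x₀ x).re / ‖x₀‖ ^ 2, ?_⟩
    rw [Complex.ofReal_div]
    congr 1
    apply Complex.ext <;> simp [h]
  rw [hc, map_sub, map_smul, PiLp.sub_apply, PiLp.smul_apply, smul_eq_mul, mul_sub, Complex.sub_im,
    mul_left_comm, Complex.im_ofReal_mul]
  simp
  ring_nf
  simp

/-! ### Deterministic contraction on the good event -/

/-- The conditions on a configuration, for the points of a finite set `N`, that make the
alternating projections operator contract near `x₀`. -/
structure GoodOn {m n : ℕ} (a : Fin m → Fin n → ℂ) (x₀ : EuclideanSpace ℂ (Fin n))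
    (N : Finset (EuclideanSpace ℂ (Fin n))) : Prop where
  upper : ∀ c ∈ N, ‖sensing a c‖ ^ 2 ≤ 4 * m
  lower : ∀ c ∈ N, 98 / 100 * m ≤ ‖sensing a c‖ ^ 2
  tangential : ∀ c ∈ N, ‖tangentialMap a x₀ c‖ ^ 2 ≤ 52 / 100 * m
  tail : ∀ c ∈ N, ∑ k, max (‖sensing a c k‖ - 10) 0 ^ 2 ≤ 1 / 10 ^ 6 * m
  small : ∑ k, (if ‖sensing a x₀ k‖ ≤ 1 / 10 ^ 5 * ‖x₀‖ then (1 : ℝ) else 0) ≤ 1 / 10 ^ 8 * m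

section
variable {m n : ℕ} {a : Fin m → Fin n → ℂ} {x₀ : EuclideanSpace ℂ (Fin n)}
  {N : Finset (EuclideanSpace ℂ (Fin n))}

theorem GoodOn.norm_sensing_le (h : GoodOn a x₀ N)
    (hN : ∀ x : EuclideanSpace ℂ (Fin n), ‖x‖ = 1 → ∃ c ∈ N, ‖x - c‖ ≤ 1 / 10 ^ 4)
    (x : EuclideanSpace ℂ (Fin n)) : ‖sensing a x‖ ≤ 3 * √m * ‖x‖ := by
  refine (opNorm_le_of_net (by norm_num) hN ((sensing a).restrictScalars ℝ) (C := 2 * √m)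
    (by positivity) (fun c hc => ?_) x).trans ?_
  · apply le_of_sq_le_sq _ (by positivity)
    rw [mul_pow, Real.sq_sqrt (by positivity)]
    exact (h.upper c hc).trans (by norm_num)
  · gcongr
    rw [div_le_iff₀ (by norm_num)]
    nlinarith [Real.sqrt_nonneg (m : ℝ)]

theorem exists_unit_smul {E : Type*} [NormedAddCommGroup E] [NormedSpace ℂ E] {x : E}
    (hx : x ≠ 0) : ∃ u : E, ‖u‖ = 1 ∧ x = (‖x‖ : ℂ) • u := by
  have h : (‖x‖ : ℂ) ≠ 0 := by exact_mod_cast norm_ne_zero_iff.2 hx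
  refine ⟨(‖x‖ : ℂ)⁻¹ • x, ?_, by rw [smul_inv_smul₀ h]⟩
  rw [norm_smul, norm_inv, Complex.norm_real, norm_norm, inv_mul_cancel₀ (norm_ne_zero_iff.2 hx)]

theorem GoodOn.le_norm_sensing (h : GoodOn a x₀ N)
    (hN : ∀ x : EuclideanSpace ℂ (Fin n), ‖x‖ = 1 → ∃ c ∈ N, ‖x - c‖ ≤ 1 / 10 ^ 4)
    (x : EuclideanSpace ℂ (Fin n)) : 98 / 100 * √m * ‖x‖ ≤ ‖sensing a x‖ := by
  by_cases hx : x = 0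
  · simp [hx]
  obtain ⟨u, hu, hxu⟩ := exists_unit_smul hx
  have key : 98 / 100 * √m ≤ ‖sensing a u‖ := by
    obtain ⟨c, hc, huc⟩ := hN u hu
    have h1 : 989 / 1000 * √m ≤ ‖sensing a c‖ := by
      apply le_of_sq_le_sq _ (norm_nonneg _)
      rw [mul_pow, Real.sq_sqrt (by positivity)]
      refine le_trans ?_ (h.lower c hc)
      gcongr
      norm_num
    have h2 : ‖sensing a (u - c)‖ ≤ 3 * √m * (1 / 10 ^ 4) :=
      (h.norm_sensing_le hN _).trans (by gcongr)
    have h3 : ‖sensing a c‖ ≤ ‖sensing a u‖ + ‖sensing a (u - c)‖ := by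
      rw [map_sub, norm_sub_rev]
      exact norm_le_norm_add_norm_sub' _ _
    nlinarith [Real.sqrt_nonneg (m : ℝ)]
  conv_rhs => rw [hxu, map_smul, norm_smul, Complex.norm_real, norm_norm]
  rw [mul_comm]
  gcongr

theorem GoodOn.norm_tangential_le (h : GoodOn a x₀ N)
    (hN : ∀ x : EuclideanSpace ℂ (Fin n), ‖x‖ = 1 → ∃ c ∈ N, ‖x - c‖ ≤ 1 / 10 ^ 4)
    (x : EuclideanSpace ℂ (Fin n)) : ‖tangentialMap a x₀ x‖ ≤ 73 / 100 * √m * ‖x‖ := by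
  refine (opNorm_le_of_net (by norm_num) hN (tangentialMap a x₀) (C := 722 / 1000 * √m)
    (by positivity) (fun c hc => ?_) x).trans ?_
  · apply le_of_sq_le_sq _ (by positivity)
    rw [mul_pow, Real.sq_sqrt (by positivity)]
    refine (h.tangential c hc).trans ?_
    gcongr
    norm_num
  · gcongr
    rw [div_le_iff₀ (by norm_num)]
    nlinarith [Real.sqrt_nonneg (m : ℝ)]

/-- Soft thresholding `t ↦ max (t - 10) 0` is 1-Lipschitz, so passing from the net to the sphere
costs at most `‖A (u - c)‖`. A hard cutoff would not allow this. -/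
theorem GoodOn.sum_tail_le (h : GoodOn a x₀ N)
    (hN : ∀ x : EuclideanSpace ℂ (Fin n), ‖x‖ = 1 → ∃ c ∈ N, ‖x - c‖ ≤ 1 / 10 ^ 4)
    {u : EuclideanSpace ℂ (Fin n)} (hu : ‖u‖ = 1) :
    ∑ k, max (‖sensing a u k‖ - 10) 0 ^ 2 ≤ (13 / 10 ^ 4) ^ 2 * m := by
  obtain ⟨c, hc, huc⟩ := hN u hu
  let T : EuclideanSpace ℂ (Fin n) → EuclideanSpace ℝ (Fin m) := fun x =>
    WithLp.toLp 2 fun k => max (‖sensing a x k‖ - 10) 0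
  have hT : ∀ x, ‖T x‖ ^ 2 = ∑ k, max (‖sensing a x k‖ - 10) 0 ^ 2 := by
    intro x
    rw [EuclideanSpace.norm_sq_eq]
    simp [T]
  have h1 : ‖T u - T c‖ ≤ ‖sensing a (u - c)‖ := by
    apply le_of_sq_le_sq _ (norm_nonneg _)
    rw [EuclideanSpace.norm_sq_eq, EuclideanSpace.norm_sq_eq]
    refine Finset.sum_le_sum fun k _ => pow_le_pow_left₀ (norm_nonneg _) ?_ 2
    rw [PiLp.sub_apply, Real.norm_eq_abs]
    refine (abs_max_sub_max_le_abs _ _ _).trans ?_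
    rw [sub_sub_sub_cancel_right, map_sub, PiLp.sub_apply]
    exact abs_norm_sub_norm_le _ _
  have h2 : ‖sensing a (u - c)‖ ≤ 3 * √m * (1 / 10 ^ 4) :=
    (h.norm_sensing_le hN _).trans (by gcongr)
  have h3 : ‖T c‖ ≤ 1 / 10 ^ 3 * √m := by
    apply le_of_sq_le_sq _ (by positivity)
    rw [mul_pow, Real.sq_sqrt (by positivity), hT]
    exact (h.tail c hc).trans (by norm_num)
  have h4 : ‖T u‖ ≤ 13 / 10 ^ 4 * √m := by
    have := norm_le_norm_add_norm_sub' (T u) (T c)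
    linarith
  rw [← hT, ← Real.sq_sqrt (show (0 : ℝ) ≤ m by positivity), ← mul_pow]
  exact pow_le_pow_left₀ (norm_nonneg _) h4 2

theorem GoodOn.sum_large_le (h : GoodOn a x₀ N)
    (hN : ∀ x : EuclideanSpace ℂ (Fin n), ‖x‖ = 1 → ∃ c ∈ N, ‖x - c‖ ≤ 1 / 10 ^ 4)
    {x : EuclideanSpace ℂ (Fin n)} (hx : ‖x‖ ≤ 5 / 10 ^ 8 * ‖x₀‖) :
    ∑ k, (if ‖sensing a x₀ k‖ ≤ 10 * ‖sensing a x k‖ then ‖sensing a x₀ k‖ else 0) ^ 2 ≤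
      (1 / 25 * √m * ‖x‖) ^ 2 := by
  by_cases hx0 : x = 0
  · subst hx0
    refine le_of_eq_of_le (Finset.sum_eq_zero fun k _ => ?_) (by positivity)
    split_ifs with hk
    · have : ‖sensing a x₀ k‖ ≤ 0 := by simpa using hk
      rw [le_antisymm this (norm_nonneg _)]; norm_num
    · norm_num
  obtain ⟨u, hu, hxu⟩ := exists_unit_smul hx0
  have hk : ∀ k, ‖sensing a x k‖ = ‖x‖ * ‖sensing a u k‖ := by
    intro k
    conv_lhs => rw [hxu, map_smul, PiLp.smul_apply, norm_smul, Complex.norm_real, norm_norm]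
  have hterm : ∀ k, (if ‖sensing a x₀ k‖ ≤ 10 * ‖sensing a x k‖ then ‖sensing a x₀ k‖ else 0) ^ 2 ≤
      400 * ‖x‖ ^ 2 * max (‖sensing a u k‖ - 10) 0 ^ 2 +
        40000 * ‖x‖ ^ 2 * (if ‖sensing a x₀ k‖ ≤ 1 / 10 ^ 5 * ‖x₀‖ then (1 : ℝ) else 0) := by
    intro k
    have hp1 : 0 ≤ 400 * ‖x‖ ^ 2 * max (‖sensing a u k‖ - 10) 0 ^ 2 := by positivity
    have hp2 : 0 ≤ 40000 * ‖x‖ ^ 2 *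
        (if ‖sensing a x₀ k‖ ≤ 1 / 10 ^ 5 * ‖x₀‖ then (1 : ℝ) else 0) := by
      split_ifs <;> positivity
    by_cases h1 : ‖sensing a x₀ k‖ ≤ 10 * ‖sensing a x k‖
    · rw [if_pos h1]
      rw [hk] at h1
      -- For `|A u| ≥ 20` the excess over 10 is at least half of `|A u|`, so the tail sum pays.
      -- Otherwise `|A x₀| ≤ 200 ‖x‖ ≤ 10⁻⁵ ‖x₀‖`, so the entry is among the rare small ones; this
      -- fixes the radius `5 / 10 ^ 8`.
      by_cases h2 : 20 ≤ ‖sensing a u k‖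
      · have h3 : ‖sensing a x₀ k‖ ≤ 20 * ‖x‖ * max (‖sensing a u k‖ - 10) 0 := by
          refine h1.trans ?_
          rw [max_eq_left (by linarith)]
          nlinarith [norm_nonneg x]
        have h4 := pow_le_pow_left₀ (norm_nonneg _) h3 2
        refine (h4.trans (le_of_eq ?_)).trans (le_add_of_nonneg_right hp2)
        ring
      · push Not at h2
        have h3 : ‖sensing a x₀ k‖ ≤ 200 * ‖x‖ := by
          refine h1.trans ?_
          nlinarith [norm_nonneg x]
        rw [if_pos (by linarith)]
        have h4 := pow_le_pow_left₀ (norm_nonneg _) h3 2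
        refine (h4.trans (le_of_eq ?_)).trans (le_add_of_nonneg_left hp1)
        ring
    · rw [if_neg h1, zero_pow two_ne_zero]
      exact add_nonneg hp1 hp2
  refine (Finset.sum_le_sum fun k _ => hterm k).trans ?_
  rw [Finset.sum_add_distrib, ← Finset.mul_sum, ← Finset.mul_sum, mul_pow, mul_pow,
    Real.sq_sqrt (by positivity)]
  have h1 := mul_le_mul_of_nonneg_left (h.sum_tail_le hN hu) (show 0 ≤ 400 * ‖x‖ ^ 2 by positivity)
  have h2 := mul_le_mul_of_nonneg_left h.small (show 0 ≤ 40000 * ‖x‖ ^ 2 by positivity)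
  have h3 : 0 ≤ ‖x‖ ^ 2 * (m : ℝ) := by positivity
  norm_num at h1 h2 ⊢
  nlinarith

theorem GoodOn.phaseDist_altProj_le (h : GoodOn a x₀ N) (hm : 0 < m)
    (hN : ∀ x : EuclideanSpace ℂ (Fin n), ‖x‖ = 1 → ∃ c ∈ N, ‖x - c‖ ≤ 1 / 10 ^ 4)
    {x : EuclideanSpace ℂ (Fin n)} (hx : phaseDist x₀ x ≤ 5 / 10 ^ 8 * ‖x₀‖) :
    phaseDist x₀ (altProj (measurementMatrix a) (measurements (measurementMatrix a) x₀) x) ≤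
      95 / 100 * phaseDist x₀ x := by
  have hmpos : 0 < √(m : ℝ) := Real.sqrt_pos.2 (by exact_mod_cast hm)
  obtain ⟨φ, hφ, him⟩ := exists_phaseDist_eq x₀ x
  refine (phaseDist_le x₀ _ φ).trans ?_
  set ω := Complex.exp (φ * Complex.I) with hω
  have hω1 : ‖ω‖ = 1 := Complex.norm_exp_ofReal_mul_I φ
  have hωω : star ω * ω = 1 := by
    have := Complex.conj_mul' ω
    rw [hω1] at this
    simpa using this
  -- the perturbation, rotated so that the base point is `x₀`
  set y := star ω • (x - ω • x₀) with hy
  have hxy : x = ω • x₀ + ω • y := by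
    rw [hy, smul_smul, mul_comm, hωω, one_smul]; abel
  have hynorm : ‖y‖ = phaseDist x₀ x := by
    rw [hφ, hy, norm_smul, norm_star, hω1, one_mul, norm_sub_rev]
  have hyim : (inner ℂ x₀ y).im = 0 := by
    rw [inner_smul_left] at him
    rw [hy, inner_smul_right, inner_sub_right, inner_smul_right, mul_sub, ← mul_assoc, hωω, one_mul,
      Complex.sub_im, show (inner ℂ x₀ x₀).im = 0 from inner_self_im (𝕜 := ℂ) x₀, sub_zero]
    exact him
  set A := measurementMatrix a
  set b := measurements A x₀
  have hlow : ∀ x : EuclideanSpace ℂ (Fin n),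
      98 / 100 * √m * ‖x‖ ≤ ‖WithLp.toLp 2 (A *ᵥ x.ofLp)‖ := fun x => h.le_norm_sensing hN x
  set v : Fin m → ℂ := fun i => (b i : ℂ) * phase ((A *ᵥ x.ofLp) i) - (A *ᵥ (ω • x₀).ofLp) i with hv
  -- The lower bound makes `A` injective, so `A† A = 1` and the target `ω x₀` is itself in the form
  -- `A† (A ω x₀)`.
  have hdiff : ω • x₀ - altProj A b x = -WithLp.toLp 2 (pinv A *ᵥ v) := by
    have h1 : pinv A *ᵥ v = pinv A *ᵥ (fun i => (b i : ℂ) * phase ((A *ᵥ x.ofLp) i)) -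
        (ω • x₀).ofLp := by
      conv_rhs => rw [← pinv_mulVec_mulVec (by positivity) hlow (ω • x₀).ofLp, ← mulVec_sub]
      rfl
    rw [h1, WithLp.toLp_sub, neg_sub]
    rfl
  rw [hdiff, norm_neg, ← hynorm]
  have hpinv := norm_pinv_mulVec_le hlow v
  -- the two parts of the pointwise bound
  let s : EuclideanSpace ℝ (Fin m) := WithLp.toLp 2 fun k =>
    if ‖sensing a x₀ k‖ ≤ 10 * ‖sensing a y k‖ then ‖sensing a x₀ k‖ else 0
  let t : EuclideanSpace ℝ (Fin m) := WithLp.toLp 2 fun k => |tangentialMap a x₀ y k|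
  have ht : ‖t‖ ≤ 73 / 100 * √m * ‖y‖ := by
    have : ‖t‖ = ‖tangentialMap a x₀ y‖ := by
      rw [EuclideanSpace.norm_eq, EuclideanSpace.norm_eq]
      simp [t]
    rw [this]
    exact h.norm_tangential_le hN y
  have hs : ‖s‖ ≤ 1 / 25 * √m * ‖y‖ := by
    apply le_of_sq_le_sq _ (by positivity)
    rw [EuclideanSpace.norm_sq_eq]
    refine le_trans (le_of_eq ?_) (h.sum_large_le hN (x := y) (by rw [hynorm]; exact hx))
    simp [s]
  have hvst : ‖WithLp.toLp 2 v‖ ≤ ‖(2 : ℝ) • s + (10 / 9 : ℝ) • t‖ := by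
    apply le_of_sq_le_sq _ (norm_nonneg _)
    rw [EuclideanSpace.norm_sq_eq, EuclideanSpace.norm_sq_eq]
    refine Finset.sum_le_sum fun k _ => pow_le_pow_left₀ (norm_nonneg _) ?_ 2
    refine le_trans ?_ (le_abs_self _)
    have e1 : (A *ᵥ x.ofLp) k = ω * (sensing a x₀ k + sensing a y k) := by
      have : (A *ᵥ x.ofLp) k = sensing a x k := rfl
      rw [this, hxy, map_add, map_smul, map_smul, PiLp.add_apply, PiLp.smul_apply, PiLp.smul_apply,
        smul_eq_mul, smul_eq_mul, mul_add]
    have e2 : (A *ᵥ (ω • x₀).ofLp) k = ω * sensing a x₀ k := by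
      have : (A *ᵥ (ω • x₀).ofLp) k = sensing a (ω • x₀) k := rfl
      rw [this, map_smul, PiLp.smul_apply, smul_eq_mul]
    have e3 : b k = ‖ω * sensing a x₀ k‖ := by
      rw [norm_mul, hω1, one_mul]
      rfl
    have hpt := norm_mul_phase_sub_le (ω * sensing a x₀ k) (ω * (sensing a x₀ k + sensing a y k))
    have e4 : ω * (sensing a x₀ k + sensing a y k) - ω * sensing a x₀ k = ω * sensing a y k := by
      ring
    have e5 : star (ω * sensing a x₀ k) * (ω * sensing a y k) =
        star (sensing a x₀ k) * sensing a y k := by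
      rw [star_mul]
      linear_combination star (sensing a x₀ k) * sensing a y k * hωω
    rw [e4, e5, ← e3, ← e1] at hpt
    have e6 : b k = ‖sensing a x₀ k‖ := rfl
    rw [norm_mul ω, hω1, one_mul, e6] at hpt
    simp only [hv, e2, PiLp.add_apply, PiLp.smul_apply, smul_eq_mul, s, t]
    rw [tangentialMap_apply_of_im_inner_eq_zero a x₀ y hyim]
    exact hpt
  have hvn : ‖WithLp.toLp 2 v‖ ≤ 2 * ‖s‖ + 10 / 9 * ‖t‖ := by
    refine hvst.trans ((norm_add_le _ _).trans (le_of_eq ?_))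
    rw [norm_smul, norm_smul]
    norm_num
  -- The numbers close since `2 / 25 + (10 / 9) (73 / 100) < (98 / 100) (95 / 100)`.
  have hfin : 98 / 100 * √m * ‖WithLp.toLp 2 (pinv A *ᵥ v)‖ ≤ √m * (98 / 100 * (95 / 100 * ‖y‖)) := by
    have : 0 ≤ √m * ‖y‖ := by positivity
    nlinarith
  rw [mul_comm (98 / 100) √(m : ℝ), mul_assoc] at hfin
  have := le_of_mul_le_mul_left hfin hmpos
  linarith
end

/-! ### Union bound and conclusion -/

theorem measureReal_biUnion_sum_nonneg_le {Ω α : Type*} [MeasurableSpace Ω] (μ : Measure Ω)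
    [IsProbabilityMeasure μ] (N : Finset α) {f : α → Ω → ℝ} (hf : ∀ c ∈ N, Measurable (f c)) {ρ : ℝ}
    (h : ∀ c ∈ N, ∫⁻ ω, ENNReal.ofReal (Real.exp (f c ω)) ∂μ ≤ ENNReal.ofReal (Real.exp (-ρ)))
    (m : ℕ) :
    (Measure.pi fun _ : Fin m => μ).real (⋃ c ∈ N, {a | 0 ≤ ∑ k, f c (a k)}) ≤
      N.card * Real.exp (-ρ * m) := by
  refine (measureReal_biUnion_finset_le N _).trans ?_
  refine (Finset.sum_le_sum fun c hc => measure_sum_nonneg_le μ (hf c hc) (h c hc) m).trans ?_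
  rw [Finset.sum_const, nsmul_eq_mul]

theorem measurableSet_biUnion_sum_nonneg {Ω α : Type*} [MeasurableSpace Ω] (N : Finset α)
    {f : α → Ω → ℝ} (hf : ∀ c ∈ N, Measurable (f c)) (m : ℕ) :
    MeasurableSet (⋃ c ∈ N, {a : Fin m → Ω | 0 ≤ ∑ k, f c (a k)}) := by
  refine N.measurableSet_biUnion fun c hc => measurableSet_le measurable_const ?_
  exact Finset.measurable_sum _ fun k _ => (hf c hc).comp (measurable_pi_apply k)

/-- With high probability, a random configuration is good on a given net. -/
theorem exists_measurableSet_goodOn {n m : ℕ} {x₀ : EuclideanSpace ℂ (Fin n)} (hx₀ : x₀ ≠ 0)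
    {N : Finset (EuclideanSpace ℂ (Fin n))} (hN : ∀ c ∈ N, ‖c‖ = 1) :
    ∃ E : Set (Fin m → Fin n → ℂ), MeasurableSet E ∧
      1 - (4 * N.card + 1) * Real.exp (-(1 / 10 ^ 9) * m) ≤ (sensingLaw m n).real E ∧
      ∀ a ∈ E, GoodOn a x₀ N := by
  let f₁ : EuclideanSpace ℂ (Fin n) → (Fin n → ℂ) → ℝ := fun c a =>
    1 / 2 * ‖sense c.ofLp a‖ ^ 2 + (-2)
  let f₂ : EuclideanSpace ℂ (Fin n) → (Fin n → ℂ) → ℝ := fun c a =>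
    -(1 / 100) * ‖sense c.ofLp a‖ ^ 2 + 98 / 10000
  let f₃ : EuclideanSpace ℂ (Fin n) → (Fin n → ℂ) → ℝ := fun c a =>
    1 / 50 * ((star (sense x₀.ofLp a) * sense (orthComp x₀ c).ofLp a).im / ‖sense x₀.ofLp a‖) ^ 2 +
      -(52 / 5000)
  let f₄ : EuclideanSpace ℂ (Fin n) → (Fin n → ℂ) → ℝ := fun c a =>
    1 / 2 * max (‖sense c.ofLp a‖ - 10) 0 ^ 2 + -(1 / (2 * 10 ^ 6))
  let f₅ : EuclideanSpace ℂ (Fin n) → (Fin n → ℂ) → ℝ := fun c a =>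
    (if ‖sense c.ofLp a‖ ≤ 1 / 10 ^ 5 * ‖c‖ then (1 : ℝ) else 0) + -(1 / 10 ^ 8)
  have m₁ : ∀ c, Measurable (f₁ c) := fun c => by fun_prop
  have m₂ : ∀ c, Measurable (f₂ c) := fun c => by fun_prop
  have m₃ : ∀ c, Measurable (f₃ c) := fun c => by
    have : Measurable fun a : Fin n → ℂ =>
        (star (sense x₀.ofLp a) * sense (orthComp x₀ c).ofLp a).im :=
      Complex.measurable_im.comp ((continuous_star.measurable.comp (by fun_prop)).mul (by fun_prop))
    exact (((this.div (by fun_prop)).pow_const 2).const_mul _).add_const _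
  have m₄ : ∀ c, Measurable (f₄ c) := fun c => by fun_prop
  have m₅ : ∀ c, Measurable (f₅ c) := fun c =>
    (Measurable.ite (measurableSet_le (by fun_prop) (by fun_prop)) (by fun_prop)
      (by fun_prop)).add_const _
  -- Each condition fails only where some sum of tilted variables is nonnegative. The first four
  -- need the whole net; the last concerns `x₀` alone, whence the factor `4 * N.card + 1`.
  let B : Finset (EuclideanSpace ℂ (Fin n)) → (EuclideanSpace ℂ (Fin n) → (Fin n → ℂ) → ℝ) →
    Set (Fin m → Fin n → ℂ) := fun N f => ⋃ c ∈ N, {a | 0 ≤ ∑ k, f c (a k)}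
  let bad : Set (Fin m → Fin n → ℂ) := B N f₁ ∪ B N f₂ ∪ B N f₃ ∪ B N f₄ ∪ B {x₀} f₅
  have hbad : MeasurableSet bad :=
    ((((measurableSet_biUnion_sum_nonneg N (fun c _ => m₁ c) m).union
      (measurableSet_biUnion_sum_nonneg N (fun c _ => m₂ c) m)).union
      (measurableSet_biUnion_sum_nonneg N (fun c _ => m₃ c) m)).union
      (measurableSet_biUnion_sum_nonneg N (fun c _ => m₄ c) m)).union
      (measurableSet_biUnion_sum_nonneg {x₀} (fun c _ => m₅ c) m)
  refine ⟨badᶜ, hbad.compl, ?_, fun a ha => ?_⟩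
  · rw [probReal_compl_eq_one_sub hbad]
    have b₁ : (sensingLaw m n).real (B N f₁) ≤ _ := measureReal_biUnion_sum_nonneg_le _ N
      (fun c _ => m₁ c) (fun c hc => lintegral_exp_upper (hN c hc)) m
    have b₂ : (sensingLaw m n).real (B N f₂) ≤ _ := measureReal_biUnion_sum_nonneg_le _ N
      (fun c _ => m₂ c) (fun c hc => lintegral_exp_lower (hN c hc)) m
    have b₃ : (sensingLaw m n).real (B N f₃) ≤ _ := measureReal_biUnion_sum_nonneg_le _ N
      (fun c _ => m₃ c) (fun c hc => lintegral_exp_im_div x₀ (orthComp x₀ c) hx₀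
        ((norm_orthComp_le x₀ c).trans (hN c hc).le) (inner_orthComp x₀ c)) m
    have b₄ : (sensingLaw m n).real (B N f₄) ≤ _ := measureReal_biUnion_sum_nonneg_le _ N
      (fun c _ => m₄ c) (fun c hc => lintegral_exp_tail (hN c hc)) m
    have b₅ : (sensingLaw m n).real (B {x₀} f₅) ≤ _ := measureReal_biUnion_sum_nonneg_le _ {x₀}
      (fun c _ => m₅ c) (fun c hc => by
        rw [Finset.mem_singleton.1 hc]; exact lintegral_exp_small x₀ hx₀) m
    have u₁ := measureReal_union_le (μ := sensingLaw m n) (B N f₁) (B N f₂)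
    have u₂ := measureReal_union_le (μ := sensingLaw m n) (B N f₁ ∪ B N f₂) (B N f₃)
    have u₃ := measureReal_union_le (μ := sensingLaw m n) (B N f₁ ∪ B N f₂ ∪ B N f₃) (B N f₄)
    have u₄ := measureReal_union_le (μ := sensingLaw m n)
      (B N f₁ ∪ B N f₂ ∪ B N f₃ ∪ B N f₄) (B {x₀} f₅)
    rw [Finset.card_singleton, Nat.cast_one, one_mul] at b₅
    have : (sensingLaw m n).real bad ≤ (4 * N.card + 1) * Real.exp (-(1 / 10 ^ 9) * m) := by
      linarith
    linarith
  · simp only [bad, B, Set.mem_compl_iff, Set.mem_union, Set.mem_iUnion, not_or, not_exists,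
      Set.mem_ofPred_eq, not_le, Finset.mem_singleton, forall_eq] at ha
    obtain ⟨⟨⟨⟨h₁, h₂⟩, h₃⟩, h₄⟩, h₅⟩ := ha
    refine ⟨fun c hc => ?_, fun c hc => ?_, fun c hc => ?_, fun c hc => ?_, ?_⟩
    · have := h₁ c hc
      simp only [f₁] at this
      rw [Finset.sum_add_distrib, ← Finset.mul_sum, Finset.sum_const, Finset.card_univ,
        Fintype.card_fin, nsmul_eq_mul, ← norm_sensing_sq] at this
      linarith
    · have := h₂ c hc
      simp only [f₂] at this
      rw [Finset.sum_add_distrib, ← Finset.mul_sum, Finset.sum_const, Finset.card_univ,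
        Fintype.card_fin, nsmul_eq_mul, ← norm_sensing_sq] at this
      linarith
    · have := h₃ c hc
      simp only [f₃] at this
      rw [Finset.sum_add_distrib, ← Finset.mul_sum, Finset.sum_const, Finset.card_univ,
        Fintype.card_fin, nsmul_eq_mul] at this
      rw [EuclideanSpace.norm_sq_eq]
      simp only [Real.norm_eq_abs, sq_abs, tangentialMap_apply, sensing_apply_apply]
      linarith
    · have := h₄ c hc
      simp only [f₄] at this
      rw [Finset.sum_add_distrib, ← Finset.mul_sum, Finset.sum_const, Finset.card_univ,
        Fintype.card_fin, nsmul_eq_mul] at this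
      simp only [sensing_apply_apply]
      linarith
    · have := h₅
      simp only [f₅] at this
      rw [Finset.sum_add_distrib, Finset.sum_const, Finset.card_univ, Fintype.card_fin,
        nsmul_eq_mul] at this
      simp only [sensing_apply_apply]
      linarith

theorem phaseDist_zero_left {n : ℕ} (x : EuclideanSpace ℂ (Fin n)) : phaseDist 0 x = ‖x‖ := by
  simp [phaseDist]

theorem altProj_zero {m n : ℕ} (A : Matrix (Fin m) (Fin n) ℂ) (x : EuclideanSpace ℂ (Fin n)) :
    altProj A (measurements A 0) x = 0 := by
  have : (fun i => (measurements A 0 i : ℂ) * phase ((A *ᵥ x.ofLp) i)) = 0 := by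
    funext i
    simp [measurements]
  rw [altProj, this, mulVec_zero, WithLp.toLp_zero]

theorem theorem1 :
    ∃ ε C₁ C₂ M δ : ℝ, 0 < ε ∧ 0 < C₁ ∧ 0 < C₂ ∧ 0 < M ∧ 0 < δ ∧ δ < 1 ∧
      ∀ (n m : ℕ), 0 < n → 0 < m → M * (n : ℝ) ≤ (m : ℝ) →
        ∀ x₀ : EuclideanSpace ℂ (Fin n),
          ∃ E : Set (Fin m → Fin n → ℂ), MeasurableSet E ∧
            1 - C₁ * Real.exp (-C₂ * (m : ℝ)) ≤ (sensingLaw m n).real E ∧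
            ∀ a ∈ E, ∀ x : EuclideanSpace ℂ (Fin n), phaseDist x₀ x ≤ ε * ‖x₀‖ →
              phaseDist x₀
                  (altProj (measurementMatrix a) (measurements (measurementMatrix a) x₀) x) ≤
                δ * phaseDist x₀ x := by
  have hlog : 0 < Real.log (3 / (1 / 10 ^ 4)) := Real.log_pos (by norm_num)
  -- Half of the Chernoff rate `10⁻⁹` is spent on the net: its cardinality is at most `(3 · 10⁴) ^
  -- (2n)`, and `M` is chosen so that this is at most `exp (m / (2 · 10⁹))`. The constant 5 absorbs
  -- `4 * N.card + 1`.
  refine ⟨5 / 10 ^ 8, 5, 1 / 10 ^ 9 / 2, 4 * Real.log (3 / (1 / 10 ^ 4)) * 10 ^ 9, 95 / 100,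
    by norm_num, by norm_num, by norm_num, by positivity, by norm_num, by norm_num, ?_⟩
  intro n m _ hm hmn x₀
  -- For `x₀ = 0` every entry of `A x₀` counts as small, so the good event is unavailable; but then
  -- `b = 0` and the operator returns `x₀` exactly.
  by_cases hx₀ : x₀ = 0
  · subst hx₀
    refine ⟨Set.univ, MeasurableSet.univ, ?_, fun a _ x _ => ?_⟩
    · rw [probReal_univ]
      have := Real.exp_pos (-(1 / 10 ^ 9 / 2) * (m : ℝ))
      linarith
    · rw [altProj_zero, phaseDist_zero_left, phaseDist_zero_left, norm_zero]
      positivity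
  obtain ⟨N, hN1, hcard, hnet⟩ := exists_sphere_net (EuclideanSpace ℂ (Fin n))
    (r := 1 / 10 ^ 4) (by norm_num) (by norm_num)
  obtain ⟨E, hE, hprob, hgood⟩ := exists_measurableSet_goodOn (m := m) hx₀ hN1
  refine ⟨E, hE, le_trans ?_ hprob, fun a ha x hx => (hgood a ha).phaseDist_altProj_le hm hnet hx⟩
  -- The net lives in the real dimension `2 n`, because the tangential map is only real-linear.
  have hdim : Module.finrank ℝ (EuclideanSpace ℂ (Fin n)) = 2 * n := by
    rw [finrank_real_of_complex, finrank_euclideanSpace, Fintype.card_fin]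
  rw [hdim] at hcard
  have h1 : ((3 : ℝ) / (1 / 10 ^ 4)) ^ (2 * n) ≤ Real.exp (1 / 10 ^ 9 / 2 * m) := by
    rw [← Real.exp_log (show (0 : ℝ) < 3 / (1 / 10 ^ 4) by norm_num), ← Real.exp_nat_mul]
    apply Real.exp_le_exp.2
    push_cast
    linarith
  have h2 : 1 ≤ Real.exp (1 / 10 ^ 9 / 2 * (m : ℝ)) := Real.one_le_exp (by positivity)
  have h3 : Real.exp (1 / 10 ^ 9 / 2 * (m : ℝ)) * Real.exp (-(1 / 10 ^ 9) * m) =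
      Real.exp (-(1 / 10 ^ 9 / 2) * m) := by
    rw [← Real.exp_add]; congr 1; ring
  have h4 : (4 * (N.card : ℝ) + 1) * Real.exp (-(1 / 10 ^ 9) * m) ≤
      5 * Real.exp (1 / 10 ^ 9 / 2 * (m : ℝ)) * Real.exp (-(1 / 10 ^ 9) * m) := by
    gcongr
    linarith
  rw [mul_assoc, h3] at h4
  linarith
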